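/- For $p=0$ or $p$ prime let $\mathcal{V}_p$ be the smallest variety of lattices that contains the lattices $\mathsf{L}(V_F)$ of all linear subspaces of $V_F$, where $F$ is any division ring of characteristic $p$ and $V_F$ any vector space over $F$ (of any dimension). The problem $\mathrm{REF}_{\mathcal{V}_p}$ is: given two lattice terms $t(\bar x), s(\bar x)$, are there $A\in\mathcal{V}_p$ and $\bar a$ in $A$ with $t(\bar a)\neq s(\bar a)$ in $A$? For a ring $R$, the problem $\mathrm{FEAS}_{\mathbb{Z},R}$ is: given a finite list of terms $p_i(\bar x)$ in the signature $0,1,+,-,\cdot$ of rings, is there $\bar r$ in $R$ with $p_i(\bar r)=0$ in $R$ for all $i$? A p-time reduction is a translation of inputs, computed by a Turing machine in polynomial time, that preserves and reflects the answer. Then the following hold, both when the lattice signature consists of join and meet only and when the bounds $0,1$ are included as constants (so that terms may contain them and $\mathcal{V}_p$ is a variety of bounded lattices). 1. There is a p-time reduction of $\mathrm{REF}_{\mathcal{V}_0}$ to $\mathrm{FEAS}_{\mathbb{Z},\mathbb{R}}$. 2. For each prime $p$ there is a p-time reduction of $\mathrm{REF}_{\mathcal{V}_p}$ to $\mathrm{FEAS}_{\mathbb{Z},F_p}$,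 where $F_p$ is the field with $p$ elements. In particular, $\mathrm{REF}_{\mathcal{V}_p}$ is in $\mathcal{NP}$. -/

import Mathlib

universe u

namespace LatticeRefutability

/-! ### Decision problems, polynomial-time reductions, NP -/

/-- A decision problem: a type of inputs, an unambiguous way to write inputs as words over a
finite alphabet, and the set of inputs whose answer is "yes". -/
structure DecisionProblem where
  /-- the inputs -/
  Input : Type
  /-- the alphabet -/
  Symbol : Type
  /-- the alphabet is finite -/
  symbolFintype : Fintype Symbol
  /-- the word that represents an input -/
  encode : Input → List Symbol
  /-- different inputs are represented by different words -/
  encode_injective : Function.Injective encode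
  /-- the inputs with answer "yes" -/
  Yes : Input → Prop

/-- `P` reduces to `Q` in polynomial time: some translation of inputs that is computed by a
(multi-stack) Turing machine in polynomially many steps preserves and reflects "yes". -/
def PTimeReduces (P Q : DecisionProblem) : Prop :=
  ∃ f : P.Input → Q.Input,
    Nonempty (Turing.TM2ComputableInPolyTime P.encode Q.encode f) ∧
      ∀ x, P.Yes x ↔ Q.Yes (f x)

/-- The word for an input `x` together with a binary word `w`: the word for `x` followed by `w`,
over the disjoint union of the two alphabets. -/
def DecisionProblem.encodeWithWitness (P : DecisionProblem) (y : P.Input × List Bool) :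
    List (P.Symbol ⊕ Bool) :=
  (P.encode y.1).map Sum.inl ++ y.2.map Sum.inr

/-- `P` is in NP: there are a polynomial `q` and a verifier `V`, computed by a Turing machine in
polynomial time, such that `x` is a "yes" input iff `V` accepts `x` together with some binary
word `w` (a certificate) of length at most `q` of the length of `x`. -/
def InNP (P : DecisionProblem) : Prop :=
  ∃ (q : Polynomial ℕ) (V : P.Input × List Bool → Bool),
    Nonempty (Turing.TM2ComputableInPolyTime P.encodeWithWitness (fun b : Bool => [b]) V) ∧
      ∀ x, P.Yes x ↔
        ∃ w : List Bool, w.length ≤ q.eval (P.encode x).length ∧ V (x, w) = true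

/-- A block of `a`s closed by `b ≠ a` can be read off from the front of a word. -/
theorem replicate_append_cons_inj {α : Type*} {a b : α} (hab : b ≠ a) :
    ∀ {m n : ℕ} {r r' : List α},
      List.replicate m a ++ b :: r = List.replicate n a ++ b :: r' → m = n ∧ r = r'
  | 0, 0, _, _, h => by simpa using h
  | 0, n + 1, _, _, h => by simp [List.replicate_succ, hab] at h
  | m + 1, 0, _, _, h => by simp [List.replicate_succ, hab.symm] at h
  | m + 1, n + 1, _, _, h => by
      have := replicate_append_cons_inj hab (m := m) (n := n)
        (by simpa [List.replicate_succ] using h)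
      exact ⟨by rw [this.1], this.2⟩

/-! ### Feasibility -/

/-- Terms in the signature `0, 1, +, -, *` of rings, with variables `x_0, x_1, …`. -/
inductive RingTerm : Type
  | var (n : ℕ) : RingTerm
  | zero : RingTerm
  | one : RingTerm
  | add (t s : RingTerm) : RingTerm
  | sub (t s : RingTerm) : RingTerm
  | mul (t s : RingTerm) : RingTerm

/-- Symbols for writing ring terms. -/
inductive RingSymbol : Type
  | tick | var | zero | one | add | sub | mul
  deriving DecidableEq

instance : Fintype RingSymbol where
  elems := {.tick, .var, .zero, .one, .add, .sub, .mul}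
  complete x := by cases x <;> simp

namespace RingTerm

/-- The value of a ring term under an assignment. -/
def eval {R : Type u} [Ring R] (r : ℕ → R) : RingTerm → R
  | var n => r n
  | zero => 0
  | one => 1
  | add t s => t.eval r + s.eval r
  | sub t s => t.eval r - s.eval r
  | mul t s => t.eval r * s.eval r

/-- Prefix notation; the variable `x_n` is written as `n` ticks followed by the symbol `var`. -/
def encode : RingTerm → List RingSymbol
  | var n => List.replicate n .tick ++ [.var]
  | zero => [.zero]
  | one => [.one]
  | add t s => .add :: (t.encode ++ s.encode)
  | sub t s => .sub :: (t.encode ++ s.encode)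
  | mul t s => .mul :: (t.encode ++ s.encode)

theorem encode_append_inj (t : RingTerm) : ∀ (t' : RingTerm) (r r' : List RingSymbol),
    t.encode ++ r = t'.encode ++ r' → t = t' ∧ r = r' := by
  induction t with
  | var n =>
    intro t' r r' h
    cases t' with
    | var m =>
      have := replicate_append_cons_inj (a := RingSymbol.tick) (b := RingSymbol.var)
        (by decide) (m := n) (n := m) (r := r) (r' := r') (by simpa [encode] using h)
      exact ⟨by rw [this.1], this.2⟩
    | _ => cases n <;> simp [encode, List.replicate_succ] at h
  | zero =>
    intro t' r r' h
    cases t' with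
    | var m => cases m <;> simp [encode, List.replicate_succ] at h
    | _ => simp_all [encode]
  | one =>
    intro t' r r' h
    cases t' with
    | var m => cases m <;> simp [encode, List.replicate_succ] at h
    | _ => simp_all [encode]
  | add t s iht ihs | sub t s iht ihs | mul t s iht ihs =>
    intro t' r r' h
    cases t' with
    | var m => cases m <;> simp [encode, List.replicate_succ] at h
    | zero | one => simp [encode] at h
    | add t₂ s₂ | sub t₂ s₂ | mul t₂ s₂ =>
      simp only [encode, List.cons_append, List.cons.injEq, List.append_assoc, reduceCtorEq,
        false_and, true_and] at h
      try
        have h₁ := iht _ _ _ h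
        have h₂ := ihs _ _ _ h₁.2
        rw [h₁.1, h₂.1]
        exact ⟨rfl, h₂.2⟩

theorem encode_ne_nil (t : RingTerm) : t.encode ≠ [] := by
  cases t <;> simp [encode]

/-- A finite list of ring terms is written by writing its members one after the other. -/
def encodeList (l : List RingTerm) : List RingSymbol := l.flatMap encode

theorem encodeList_injective : Function.Injective encodeList := by
  intro l
  induction l with
  | nil =>
    intro l' h
    cases l' with
    | nil => rfl
    | cons t l' => simp [encodeList, (encode_ne_nil t)] at h
  | cons t l ih =>
    intro l' h
    cases l' with
    | nil => simp [encodeList, (encode_ne_nil t)] at h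
    | cons t' l' =>
      simp only [encodeList, List.flatMap_cons] at h
      have h₁ := encode_append_inj _ _ _ _ h
      rw [h₁.1, ih (a₂ := l') h₁.2]

end RingTerm

/-- The feasibility problem for the ring `R`: given a finite list of ring terms, do they have a
common zero in `R`? -/
abbrev FEAS (R : Type u) [Ring R] : DecisionProblem where
  Input := List RingTerm
  Symbol := RingSymbol
  symbolFintype := inferInstance
  encode := RingTerm.encodeList
  encode_injective := RingTerm.encodeList_injective
  Yes l := ∃ r : ℕ → R, ∀ t ∈ l, t.eval r = 0

/-! ### Lattice terms, with and without constants for the bounds -/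

/-- Symbols for writing lattice terms (`zero` and `one` are used only if the bounds are
constants of the signature). -/
inductive LatSymbol : Type
  | tick | var | zero | one | join | meet
  deriving DecidableEq

instance : Fintype LatSymbol where
  elems := {.tick, .var, .zero, .one, .join, .meet}
  complete x := by cases x <;> simp

/-- Lattice terms in the signature with join and meet only. -/
inductive LatTerm : Type
  | var (n : ℕ) : LatTerm
  | join (t s : LatTerm) : LatTerm
  | meet (t s : LatTerm) : LatTerm

/-- Lattice terms in the signature with join, meet and constants for the bounds. -/
inductive BLatTerm : Type
  | var (n : ℕ) : BLatTerm
  | zero : BLatTerm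
  | one : BLatTerm
  | join (t s : BLatTerm) : BLatTerm
  | meet (t s : BLatTerm) : BLatTerm

namespace LatTerm

/-- The value of a lattice term under an assignment. -/
def eval {A : Type u} [Lattice A] (a : ℕ → A) : LatTerm → A
  | var n => a n
  | join t s => t.eval a ⊔ s.eval a
  | meet t s => t.eval a ⊓ s.eval a

/-- Prefix notation; the variable `x_n` is written as `n` ticks followed by the symbol `var`. -/
def encode : LatTerm → List LatSymbol
  | var n => List.replicate n .tick ++ [.var]
  | join t s => .join :: (t.encode ++ s.encode)
  | meet t s => .meet :: (t.encode ++ s.encode)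

theorem encode_append_inj (t : LatTerm) : ∀ (t' : LatTerm) (r r' : List LatSymbol),
    t.encode ++ r = t'.encode ++ r' → t = t' ∧ r = r' := by
  induction t with
  | var n =>
    intro t' r r' h
    cases t' with
    | var m =>
      have := replicate_append_cons_inj (a := LatSymbol.tick) (b := LatSymbol.var)
        (by decide) (m := n) (n := m) (r := r) (r' := r') (by simpa [encode] using h)
      exact ⟨by rw [this.1], this.2⟩
    | _ => cases n <;> simp [encode, List.replicate_succ] at h
  | join t s iht ihs | meet t s iht ihs =>
    intro t' r r' h
    cases t' with
    | var m => cases m <;> simp [encode, List.replicate_succ] at h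
    | join t₂ s₂ | meet t₂ s₂ =>
      simp only [encode, List.cons_append, List.cons.injEq, List.append_assoc, reduceCtorEq,
        false_and, true_and] at h
      try
        have h₁ := iht _ _ _ h
        have h₂ := ihs _ _ _ h₁.2
        rw [h₁.1, h₂.1]
        exact ⟨rfl, h₂.2⟩

/-- A pair of terms is written by writing the two terms one after the other. -/
def encodePair (e : LatTerm × LatTerm) : List LatSymbol := e.1.encode ++ e.2.encode

theorem encodePair_injective : Function.Injective encodePair := by
  rintro ⟨t, s⟩ ⟨t', s'⟩ h
  obtain ⟨rfl, h⟩ := encode_append_inj _ _ _ _ h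
  obtain ⟨rfl, -⟩ := encode_append_inj s s' [] [] (by simpa using h)
  rfl

end LatTerm

namespace BLatTerm

/-- The value of a term under an assignment. -/
def eval {A : Type u} [Lattice A] [BoundedOrder A] (a : ℕ → A) : BLatTerm → A
  | var n => a n
  | zero => ⊥
  | one => ⊤
  | join t s => t.eval a ⊔ s.eval a
  | meet t s => t.eval a ⊓ s.eval a

/-- Prefix notation; the variable `x_n` is written as `n` ticks followed by the symbol `var`. -/
def encode : BLatTerm → List LatSymbol
  | var n => List.replicate n .tick ++ [.var]
  | zero => [.zero]
  | one => [.one]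
  | join t s => .join :: (t.encode ++ s.encode)
  | meet t s => .meet :: (t.encode ++ s.encode)

theorem encode_append_inj (t : BLatTerm) : ∀ (t' : BLatTerm) (r r' : List LatSymbol),
    t.encode ++ r = t'.encode ++ r' → t = t' ∧ r = r' := by
  induction t with
  | var n =>
    intro t' r r' h
    cases t' with
    | var m =>
      have := replicate_append_cons_inj (a := LatSymbol.tick) (b := LatSymbol.var)
        (by decide) (m := n) (n := m) (r := r) (r' := r') (by simpa [encode] using h)
      exact ⟨by rw [this.1], this.2⟩
    | _ => cases n <;> simp [encode, List.replicate_succ] at h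
  | zero =>
    intro t' r r' h
    cases t' with
    | var m => cases m <;> simp [encode, List.replicate_succ] at h
    | _ => simp_all [encode]
  | one =>
    intro t' r r' h
    cases t' with
    | var m => cases m <;> simp [encode, List.replicate_succ] at h
    | _ => simp_all [encode]
  | join t s iht ihs | meet t s iht ihs =>
    intro t' r r' h
    cases t' with
    | var m => cases m <;> simp [encode, List.replicate_succ] at h
    | zero | one => simp [encode] at h
    | join t₂ s₂ | meet t₂ s₂ =>
      simp only [encode, List.cons_append, List.cons.injEq, List.append_assoc, reduceCtorEq,
        false_and, true_and] at h
      try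
        have h₁ := iht _ _ _ h
        have h₂ := ihs _ _ _ h₁.2
        rw [h₁.1, h₂.1]
        exact ⟨rfl, h₂.2⟩

/-- A pair of terms is written by writing the two terms one after the other. -/
def encodePair (e : BLatTerm × BLatTerm) : List LatSymbol := e.1.encode ++ e.2.encode

theorem encodePair_injective : Function.Injective encodePair := by
  rintro ⟨t, s⟩ ⟨t', s'⟩ h
  obtain ⟨rfl, h⟩ := encode_append_inj _ _ _ _ h
  obtain ⟨rfl, -⟩ := encode_append_inj s s' [] [] (by simpa using h)
  rfl

end BLatTerm

/-! ### Varieties and refutability, bounds not in the signature -/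

/-- A class of lattices. -/
abbrev LatClass := ∀ (A : Type u) [Lattice A], Prop

/-- A variety of lattices: the class of all lattices that satisfy some set of identities. -/
def IsLatVariety (K : LatClass.{u}) : Prop :=
  ∃ E : Set (LatTerm × LatTerm), ∀ (A : Type u) [Lattice A],
    K A ↔ ∀ e ∈ E, ∀ a : ℕ → A, e.1.eval a = e.2.eval a

/-- The smallest variety of lattices that contains the subspace lattices of all vector spaces
over division rings of characteristic `p`. -/
def subspaceVariety (p : ℕ) : LatClass.{u} := fun A _ =>
  ∀ K : LatClass.{u}, IsLatVariety K →
    (∀ (F V : Type u) [DivisionRing F] [CharP F p] [AddCommGroup V] [Module F V],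
      K (Submodule F V)) →
    K A

/-- Refutability for the class `K`: given lattice terms `t, s`, is there a member of `K` in which
`t` and `s` have different values under some assignment? -/
abbrev REF (K : LatClass.{u}) : DecisionProblem where
  Input := LatTerm × LatTerm
  Symbol := LatSymbol
  symbolFintype := inferInstance
  encode := LatTerm.encodePair
  encode_injective := LatTerm.encodePair_injective
  Yes e := ∃ (A : Type u) (_ : Lattice A), K A ∧ ∃ a : ℕ → A, e.1.eval a ≠ e.2.eval a

/-! ### Varieties and refutability, bounds in the signature -/

/-- A class of bounded lattices. -/
abbrev BLatClass := ∀ (A : Type u) [Lattice A] [BoundedOrder A], Prop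

/-- A variety of bounded lattices: the class of all bounded lattices that satisfy some set of
identities, in which the bounds may occur as constants. -/
def IsBLatVariety (K : BLatClass.{u}) : Prop :=
  ∃ E : Set (BLatTerm × BLatTerm), ∀ (A : Type u) [Lattice A] [BoundedOrder A],
    K A ↔ ∀ e ∈ E, ∀ a : ℕ → A, e.1.eval a = e.2.eval a

/-- The smallest variety of bounded lattices that contains the subspace lattices of all vector
spaces over division rings of characteristic `p`. -/
def boundedSubspaceVariety (p : ℕ) : BLatClass.{u} := fun A _ _ =>
  ∀ K : BLatClass.{u}, IsBLatVariety K →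
    (∀ (F V : Type u) [DivisionRing F] [CharP F p] [AddCommGroup V] [Module F V],
      K (Submodule F V)) →
    K A

/-- Refutability for the class `K` of bounded lattices: given terms `t, s`, in which the bounds
may occur as constants, is there a member of `K` in which `t` and `s` have different values under
some assignment? -/
abbrev boundedREF (K : BLatClass.{u}) : DecisionProblem where
  Input := BLatTerm × BLatTerm
  Symbol := LatSymbol
  symbolFintype := inferInstance
  encode := BLatTerm.encodePair
  encode_injective := BLatTerm.encodePair_injective
  Yes e := ∃ (A : Type u) (_ : Lattice A) (_ : BoundedOrder A),
    K A ∧ ∃ a : ℕ → A, e.1.eval a ≠ e.2.eval a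

end LatticeRefutability

open LatticeRefutability

/-! The lattices that satisfy a single identity form a variety. Hence t = s fails in the smallest
variety containing the subspace lattices exactly when it fails in one of those lattices
(`REF_yes_iff`, `boundedREF_yes_iff`). Restriction of scalars to the prime field k embeds the
lattice of F-subspaces into that of k-subspaces, bounds included, so the division ring may be
replaced by k (`exists_solution_of_algebra`).

Over a field, t(a) ≠ s(a) is witnessed by a vector in one value and a functional φ that vanishes on
the other, with φ(v) = 1. Membership of v in t(a) is certified by vectors w_i at the nodes of t: a
sum at a join, equality at a meet, zero at the bottom, an element of the given subspace at a
variable. Vanishing of φ on t(a) is certified dually by functionals φ_j, because the annihilator of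
an intersection is the sum of the annihilators (`membership_le_ker`). The scalars φ_j(w_i), for i
and j running over all nodes of both terms, satisfy linear equations along rows and dual ones along
columns. They vanish when i and j are leaves with the same variable, and the two mixed root entries
can be arranged to add up to 1 (`exists_solution`).

Conversely, any matrix over a field with these properties refutes the identity, and no bound on
dimensions is needed. The rows are vectors in the space cut out by the column equations, the
coordinates are functionals, and a variable is interpreted by the span of the rows at its leaves. If
the two values agreed, both mixed root entries would be zero (`exists_ne_of_solution`). In
characteristic 0 a rational solution is also a real one, and a real solution refutes the identity
over the reals.

The system has boundedly many equations for each pair of nodes. Polynomial time is shown with a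
small structured language that compiles to stack machines with step counts: `does_writeSystem`
parses the terms and writes the system. For NP, a certificate lists values in `ZMod p`, and
`does_verify` writes the system and evaluates it at them. -/

namespace LatticeRefutability

open Turing

/-! ### Structured programs for stack machines -/

/-- Structured programs that act on a family of stacks, with alphabet `Γ k` for stack `k`.
`loop k c f` pops stack `k` (yielding `none` if it is empty), runs the program that `f` assigns to
the result, and starts again if `c` holds of the result. -/
inductive Prog {K : Type} (Γ : K → Type) : Type
  | skip : Prog Γ
  | push (k : K) (a : Γ k) : Prog Γ
  | seq (P Q : Prog Γ) : Prog Γ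
  | loop (k : K) (c : Option (Γ k) → Bool) (f : Option (Γ k) → Prog Γ) : Prog Γ

namespace Prog

variable {K : Type} {Γ : K → Type}

infixr:60 " ;; " => Prog.seq

/-- The program points of a program. -/
def Point : Prog Γ → Type
  | skip => Unit
  | push _ _ => Unit
  | seq P Q => P.Point ⊕ Q.Point
  | loop _ _ f => Option (Σ o, (f o).Point)

/-- This makes the label set of `machine` finite. A loop has a separate copy of its body for each
possible result of the pop, and finite alphabets leave only finitely many of these. -/
theorem finite_point [∀ k, Finite (Γ k)] : ∀ P : Prog Γ, Finite P.Point
  | skip => inferInstanceAs (Finite Unit)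
  | push _ _ => inferInstanceAs (Finite Unit)
  | seq P Q =>
    have := finite_point P
    have := finite_point Q
    inferInstanceAs (Finite (P.Point ⊕ Q.Point))
  | loop _ _ f =>
    have := fun o => finite_point (f o)
    inferInstanceAs (Finite (Option (Σ o, (f o).Point)))

/-- The program point at which a program starts. -/
def entry : (P : Prog Γ) → P.Point
  | skip => ()
  | push _ _ => ()
  | seq P _ => Sum.inl P.entry
  | loop _ _ _ => (none : Option _)

variable [DecidableEq K]

/-- The machine code of a program whose points are embedded into the labels `Λ` by `ι`, and which
jumps to `e` when it is finished. The internal state of the machine remembers the result of the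
last pop on each stack. -/
def code {Λ : Type} : (P : Prog Γ) → (P.Point → Λ) → Λ → P.Point →
    TM2.Stmt Γ Λ (∀ k, Option (Γ k))
  | skip, _, e, _ => .goto fun _ => e
  | push k a, _, e, _ => .push k (fun _ => a) (.goto fun _ => e)
  | seq P Q, ι, e, l =>
    match l with
    | Sum.inl l => P.code (fun l => ι (Sum.inl l)) (ι (Sum.inr Q.entry)) l
    | Sum.inr l => Q.code (fun l => ι (Sum.inr l)) e l
  | loop k c f, ι, e, l =>
    match l with
    | none => .pop k (fun v o => Function.update v k o)
        (.goto fun v => ι (some ⟨v k, (f (v k)).entry⟩))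
    | some ⟨o, l⟩ => (f o).code (fun l => ι (some ⟨o, l⟩)) (bif c o then ι none else e) l

/-- `StepsIn M n a b`: the machine `M` gets from `a` to `b` in exactly `n` steps. -/
def StepsIn {Λ σ : Type} (M : Λ → TM2.Stmt Γ Λ σ) (n : ℕ) (a b : TM2.Cfg Γ Λ σ) : Prop :=
  (flip bind (TM2.step M))^[n] (some a) = some b

theorem StepsIn.trans {Λ σ : Type} {M : Λ → TM2.Stmt Γ Λ σ} {m n : ℕ} {a b c : TM2.Cfg Γ Λ σ}
    (h₁ : StepsIn M m a b) (h₂ : StepsIn M n b c) : StepsIn M (m + n) a c := by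
  unfold StepsIn at *
  rw [Nat.add_comm, Function.iterate_add_apply, h₁, h₂]

/-- `Runs P S S' n`: started on stacks `S`, the program `P` finishes with stacks `S'` after at
most `n` steps. -/
def Runs (P : Prog Γ) (S S' : ∀ k, List (Γ k)) (n : ℕ) : Prop :=
  ∀ (Λ : Type) (M : Λ → TM2.Stmt Γ Λ (∀ k, Option (Γ k))) (ι : P.Point → Λ) (e : Λ),
    (∀ l, M (ι l) = P.code ι e l) → ∀ v, ∃ v', ∃ m ≤ n,
      StepsIn M m ⟨some (ι P.entry), v, S⟩ ⟨some e, v', S'⟩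

theorem Runs.mono {P : Prog Γ} {S S' : ∀ k, List (Γ k)} {m n : ℕ} (h : Runs P S S' m)
    (hmn : m ≤ n) : Runs P S S' n := by
  intro Λ M ι e hM v
  obtain ⟨v', i, hi, hs⟩ := h Λ M ι e hM v
  exact ⟨v', i, hi.trans hmn, hs⟩

theorem runs_skip (S : ∀ k, List (Γ k)) : Runs skip S S 1 := by
  intro Λ M ι e hM v
  refine ⟨v, 1, le_rfl, ?_⟩
  simp [StepsIn, flip, hM, code]

theorem runs_push (k : K) (a : Γ k) (S : ∀ k, List (Γ k)) :
    Runs (push k a) S (Function.update S k (a :: S k)) 1 := by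
  intro Λ M ι e hM v
  refine ⟨v, 1, le_rfl, ?_⟩
  simp [StepsIn, flip, hM, code]

/-- `Runs` quantifies over every machine that contains the code and over every exit label. The first
run can therefore be taken with the entry of `Q` as its exit, inside the machine of the composite.
-/
theorem Runs.seq {P Q : Prog Γ} {S S' S'' : ∀ k, List (Γ k)} {m n : ℕ} (h₁ : Runs P S S' m)
    (h₂ : Runs Q S' S'' n) : Runs (P ;; Q) S S'' (m + n) := by
  intro Λ M ι e hM v
  obtain ⟨v', i, hi, hs⟩ := h₁ Λ M (fun l => ι (Sum.inl l)) (ι (Sum.inr Q.entry))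
    (fun l => hM (Sum.inl l)) v
  obtain ⟨v'', j, hj, hs'⟩ := h₂ Λ M (fun l => ι (Sum.inr l)) e (fun l => hM (Sum.inr l)) v'
  exact ⟨v'', i + j, by omega, hs.trans hs'⟩

theorem runs_loop_exit {k : K} {c : Option (Γ k) → Bool} {f : Option (Γ k) → Prog Γ}
    {S S' : ∀ k, List (Γ k)} {n : ℕ} (hc : c (S k).head? = false)
    (h : Runs (f (S k).head?) (Function.update S k (S k).tail) S' n) :
    Runs (loop k c f) S S' (n + 1) := by
  intro Λ M ι e hM v
  obtain ⟨v', i, hi, hs⟩ := h Λ M (fun l => ι (some ⟨_, l⟩)) e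
    (fun l => (hM (some ⟨_, l⟩)).trans (by simp only [code, hc, cond_false]))
    (Function.update v k (S k).head?)
  refine ⟨v', 1 + i, by omega, StepsIn.trans ?_ hs⟩
  have h₀ : M (ι none) = .pop k (fun v o => Function.update v k o)
    (.goto fun v => ι (some ⟨v k, (f (v k)).entry⟩)) := hM none
  simp only [StepsIn, flip, entry, h₀, Function.iterate_one, Option.bind_eq_bind,
    Option.bind_some, TM2.step, TM2.stepAux]
  exact congrArg (fun l => some (TM2.Cfg.mk (some l) _ _))
    (congrArg (fun o => ι (some ⟨o, (f o).entry⟩)) (Function.update_self _ _ _))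

/-- The copy of the body for the popped symbol returns to the head `ι none` of the loop. The
additional 1 pays for the pop. -/
theorem runs_loop_again {k : K} {c : Option (Γ k) → Bool} {f : Option (Γ k) → Prog Γ}
    {S S' S'' : ∀ k, List (Γ k)} {m n : ℕ} (hc : c (S k).head? = true)
    (h : Runs (f (S k).head?) (Function.update S k (S k).tail) S' m)
    (h' : Runs (loop k c f) S' S'' n) :
    Runs (loop k c f) S S'' (m + 1 + n) := by
  intro Λ M ι e hM v
  obtain ⟨v', i, hi, hs⟩ := h Λ M (fun l => ι (some ⟨_, l⟩)) (ι none)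
    (fun l => (hM (some ⟨_, l⟩)).trans (by simp only [code, hc, cond_true]))
    (Function.update v k (S k).head?)
  obtain ⟨v'', j, hj, hs'⟩ := h' Λ M ι e hM v'
  refine ⟨v'', (1 + i) + j, by omega, StepsIn.trans (StepsIn.trans ?_ hs) hs'⟩
  have h₀ : M (ι none) = .pop k (fun v o => Function.update v k o)
    (.goto fun v => ι (some ⟨v k, (f (v k)).entry⟩)) := hM none
  simp only [StepsIn, flip, entry, h₀, Function.iterate_one, Option.bind_eq_bind,
    Option.bind_some, TM2.step, TM2.stepAux]
  exact congrArg (fun l => some (TM2.Cfg.mk (some l) _ _))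
    (congrArg (fun o => ι (some ⟨o, (f o).entry⟩)) (Function.update_self _ _ _))

/-- `Iter P S S' n`: a run of `P` from `S` may be obtained from a run from `S'` at the cost of at
most `n` additional steps. For a loop, this says that some iterations lead from `S` to `S'`. -/
def Iter (P : Prog Γ) (S S' : ∀ k, List (Γ k)) (n : ℕ) : Prop :=
  ∀ S'' m, Runs P S' S'' m → Runs P S S'' (n + m)

theorem Iter.refl (P : Prog Γ) (S : ∀ k, List (Γ k)) : Iter P S S 0 :=
  fun _ _ h => h.mono (by omega)

theorem Iter.trans {P : Prog Γ} {S S' S'' : ∀ k, List (Γ k)} {m n : ℕ} (h₁ : Iter P S S' m)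
    (h₂ : Iter P S' S'' n) : Iter P S S'' (m + n) :=
  fun _ _ h => (h₁ _ _ (h₂ _ _ h)).mono (by omega)

theorem Iter.mono {P : Prog Γ} {S S' : ∀ k, List (Γ k)} {m n : ℕ} (h : Iter P S S' m)
    (hmn : m ≤ n) : Iter P S S' n :=
  fun _ _ h' => (h _ _ h').mono (by omega)

/-- Empty stack `k`, and run `f a` for each symbol `a` that is popped. -/
def forEach (k : K) (f : Γ k → Prog Γ) : Prog Γ :=
  loop k Option.isSome fun o => o.elim skip f

theorem runs_forEach_nil {k : K} {f : Γ k → Prog Γ} {S : ∀ k, List (Γ k)} (h : S k = []) :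
    Runs (forEach k f) S S 2 := by
  refine runs_loop_exit (by simp [h]) ?_
  have : Function.update S k (S k).tail = S := by rw [h, List.tail_nil, ← h]; simp
  rw [this, h]
  exact runs_skip S

/-- Iterations are chained by `Iter.trans`, and the chain is closed by `runs_forEach_nil`. Loop
invariants thus become inductions on the word that is being consumed. -/
theorem iter_forEach {k : K} {f : Γ k → Prog Γ} {S S' : ∀ k, List (Γ k)} {a : Γ k}
    {l : List (Γ k)} {n : ℕ} (h : S k = a :: l) (h' : Runs (f a) (Function.update S k l) S' n) :
    Iter (forEach k f) S S' (n + 1) := by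
  intro S'' m hm
  refine runs_loop_again (by simp [h]) ?_ hm
  rw [h]
  exact h'

/-- Empty stack `k`. -/
def clear (k : K) : Prog Γ := forEach k fun _ => skip

theorem runs_clear (k : K) (S : ∀ k, List (Γ k)) :
    Runs (clear k) S (Function.update S k []) (2 * (S k).length + 2) := by
  generalize h : S k = l
  induction l generalizing S with
  | nil =>
    rw [← h, Function.update_eq_self]
    exact (runs_forEach_nil h).mono (by omega)
  | cons a l ih =>
    have := iter_forEach h (runs_skip _) _ _ (ih (Function.update S k l) (by simp))
    rw [Function.update_idem] at this
    exact this.mono (by simp; omega)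

/-- Move the contents of stack `k` to stack `k'`, translating the symbols by `g`. -/
def drain (k k' : K) (g : Γ k → Γ k') : Prog Γ := forEach k fun a => push k' (g a)

theorem runs_drain {k k' : K} (hk : k ≠ k') (g : Γ k → Γ k') (S : ∀ k, List (Γ k)) :
    Runs (drain k k' g) S
      (Function.update (Function.update S k []) k' ((S k).reverse.map g ++ S k'))
      (2 * (S k).length + 2) := by
  generalize h : S k = l
  induction l generalizing S with
  | nil =>
    have e : Function.update S k [] = S := by rw [← h, Function.update_eq_self]
    simpa [e, drain] using runs_forEach_nil h
  | cons a l ih =>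
    have := iter_forEach h (runs_push k' (g a) _) _ _ (ih _ (by simp [hk]))
    rw [Function.update_comm hk.symm, Function.update_idem, Function.update_idem] at this
    simp only [Function.update_self, Function.update_of_ne hk.symm] at this
    simpa [drain] using this.mono (n := 2 * (a :: l).length + 2) (by simp; omega)

/-- A machine that runs a program and then halts. -/
noncomputable abbrev machine [Fintype K] [∀ k, Finite (Γ k)] (P : Prog Γ) (k₀ k₁ : K) : FinTM2 where
  K := K
  k₀ := k₀
  k₁ := k₁
  Γ := Γ
  Λ := Option P.Point
  main := some P.entry
  ΛFin := have := P.finite_point; Fintype.ofFinite _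
  σ := ∀ k, Option (Γ k)
  initialState := fun _ => none
  σFin := Fintype.ofFinite _
  Γk₀Fin := Fintype.ofFinite _
  m
    | none => .load (fun _ _ => none) .halt
    | some l => P.code some none l

theorem initList_stk (tm : FinTM2) (s : List (tm.Γ tm.k₀)) :
    (initList tm s).stk = Function.update (fun _ => []) tm.k₀ s := by
  funext k
  by_cases h : k = tm.k₀
  · subst h
    simp [initList]
  · simp [initList, h]

theorem haltList_stk (tm : FinTM2) (s : List (tm.Γ tm.k₁)) :
    (haltList tm s).stk = Function.update (fun _ => []) tm.k₁ s := by
  funext k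
  by_cases h : k = tm.k₁
  · subst h
    simp [haltList]
  · simp [haltList, h]

/-- A function is computable in polynomial time if some program computes it with a polynomial
bound on the number of steps. -/
theorem polyTime_of_runs [Fintype K] [∀ k, Finite (Γ k)] (P : Prog Γ) (k₀ k₁ : K) {α β : Type}
    {ea : α → List (Γ k₀)} {eb : β → List (Γ k₁)} {f : α → β} (q : Polynomial ℕ)
    (h : ∀ x, Runs P (Function.update (fun _ => []) k₀ (ea x))
      (Function.update (fun _ => []) k₁ (eb (f x))) (q.eval (ea x).length)) :
    Nonempty (TM2ComputableInPolyTime ea eb f) := by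
  suffices H : ∀ x, Nonempty (TM2OutputsInTime (machine P k₀ k₁) (List.map id (ea x))
      (some (List.map id (eb (f x)))) ((q + 1).eval (ea x).length)) from
    ⟨⟨⟨machine P k₀ k₁, Equiv.refl _, Equiv.refl _⟩, q + 1, fun x => (H x).some⟩⟩
  intro x
  erw [List.map_id, List.map_id]
  obtain ⟨v, m, hm, hs⟩ := h x (Option P.Point) (machine P k₀ k₁).m some none (fun l => rfl)
    (fun _ => none)
  -- One more step halts and resets the internal state, as `haltList` requires; hence `q + 1`.
  have hs' := StepsIn.trans hs (n := 1) (c := ⟨none, fun _ => none,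
    Function.update (fun _ => []) k₁ (eb (f x))⟩) (by simp [StepsIn, flip])
  have e₁ : initList (machine P k₀ k₁) (ea x) =
      ⟨some (some P.entry), fun _ => none, Function.update (fun _ => []) k₀ (ea x)⟩ := by
    rw [← initList_stk (machine P k₀ k₁) (ea x)]; rfl
  have e₂ : haltList (machine P k₀ k₁) (eb (f x)) =
      ⟨none, fun _ => none, Function.update (fun _ => []) k₁ (eb (f x))⟩ := by
    rw [← haltList_stk (machine P k₀ k₁) (eb (f x))]; rfl
  refine ⟨⟨⟨m + 1, ?_⟩, by simpa using hm⟩⟩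
  rw [Option.map_some, e₁, e₂]
  exact hs'

end Prog

end LatticeRefutability

namespace LatticeRefutability

open Prog

/-! ### The memory of the machine -/

/-- The unary counters of the machine. -/
inductive Num : Type
  | cnt | x₁ | y₁ | z₁ | x₂ | y₂ | z₂ | aux₁ | aux₂ | bad
  deriving DecidableEq

instance : Fintype Num where
  elems := {.cnt, .x₁, .y₁, .z₁, .x₂, .y₂, .z₂, .aux₁, .aux₂, .bad}
  complete x := by cases x <;> simp

/-- Operations that may stand at a node of a lattice term. -/
inductive NodeOp : Type
  | var | zero | one | join | meet
  deriving DecidableEq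

instance : Fintype NodeOp where
  elems := {.var, .zero, .one, .join, .meet}
  complete x := by cases x <;> simp

/-- Symbols for writing down the nodes of lattice terms. -/
inductive NodeSymbol : Type
  | tick | sep₁ | sep₂ | op (o : NodeOp)
  deriving Fintype

/-- The stacks of the machine. -/
inductive Stk : Type
  | num (i : Num) | src | rev | log | log' | bak | names | out | outr | inp | todo | done | vals
  | ans
  deriving DecidableEq, Fintype

/-- The alphabets of the stacks, where `C` is the set of values of ring terms. -/
abbrev Alphabet (C : Type) : Stk → Type
  | .num _ => Unit
  | .src | .rev => LatSymbol
  | .log | .log' | .bak => NodeSymbol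
  | .names => Bool
  | .out | .outr => RingSymbol
  | .inp => LatSymbol ⊕ Bool
  | .todo | .done | .vals => C
  | .ans => Bool

instance (C : Type) [Finite C] : ∀ k, Finite (Alphabet C k)
  | .num _ => inferInstanceAs (Finite Unit)
  | .src | .rev => inferInstanceAs (Finite LatSymbol)
  | .log | .log' | .bak => inferInstanceAs (Finite NodeSymbol)
  | .names => inferInstanceAs (Finite Bool)
  | .out | .outr => inferInstanceAs (Finite RingSymbol)
  | .inp => inferInstanceAs (Finite (LatSymbol ⊕ Bool))
  | .todo | .done | .vals => inferInstanceAs (Finite C)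
  | .ans => inferInstanceAs (Finite Bool)

/-- The contents of all stacks; those of the counters are given by their lengths. -/
structure Mem (C : Type) : Type where
  num : Num → ℕ := fun _ => 0
  src : List LatSymbol := []
  rev : List LatSymbol := []
  log : List NodeSymbol := []
  log' : List NodeSymbol := []
  bak : List NodeSymbol := []
  names : List Bool := []
  out : List RingSymbol := []
  outr : List RingSymbol := []
  inp : List (LatSymbol ⊕ Bool) := []
  todo : List C := []
  done : List C := []
  vals : List C := []
  ans : List Bool := []

namespace Mem

variable {C : Type}

/-- The stacks that belong to a memory. -/
abbrev stack (s : Mem C) : ∀ k, List (Alphabet C k)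
  | .num i => List.replicate (s.num i) ()
  | .src => s.src
  | .rev => s.rev
  | .log => s.log
  | .log' => s.log'
  | .bak => s.bak
  | .names => s.names
  | .out => s.out
  | .outr => s.outr
  | .inp => s.inp
  | .todo => s.todo
  | .done => s.done
  | .vals => s.vals
  | .ans => s.ans

theorem update_num (s : Mem C) (i : Num) (n : ℕ) :
    Function.update s.stack (.num i) (List.replicate n ()) =
      stack { s with num := Function.update s.num i n } := by
  funext k
  cases k with
  | num j =>
    by_cases h : j = i
    · subst h; simp
    · simp [h]
  | _ => rfl

theorem update_src (s : Mem C) (l) :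
    Function.update s.stack .src l = stack { s with src := l } := by
  funext k; cases k <;> rfl
theorem update_rev (s : Mem C) (l) :
    Function.update s.stack .rev l = stack { s with rev := l } := by
  funext k; cases k <;> rfl
theorem update_log (s : Mem C) (l) :
    Function.update s.stack .log l = stack { s with log := l } := by
  funext k; cases k <;> rfl
theorem update_log' (s : Mem C) (l) :
    Function.update s.stack .log' l = stack { s with log' := l } := by
  funext k; cases k <;> rfl
theorem update_bak (s : Mem C) (l) :
    Function.update s.stack .bak l = stack { s with bak := l } := by
  funext k; cases k <;> rfl
theorem update_names (s : Mem C) (l) :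
    Function.update s.stack .names l = stack { s with names := l } := by
  funext k; cases k <;> rfl
theorem update_out (s : Mem C) (l) :
    Function.update s.stack .out l = stack { s with out := l } := by
  funext k; cases k <;> rfl
theorem update_outr (s : Mem C) (l) :
    Function.update s.stack .outr l = stack { s with outr := l } := by
  funext k; cases k <;> rfl
theorem update_inp (s : Mem C) (l) :
    Function.update s.stack .inp l = stack { s with inp := l } := by
  funext k; cases k <;> rfl
theorem update_todo (s : Mem C) (l) :
    Function.update s.stack .todo l = stack { s with todo := l } := by
  funext k; cases k <;> rfl
theorem update_done (s : Mem C) (l) :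
    Function.update s.stack .done l = stack { s with done := l } := by
  funext k; cases k <;> rfl
theorem update_vals (s : Mem C) (l) :
    Function.update s.stack .vals l = stack { s with vals := l } := by
  funext k; cases k <;> rfl
theorem update_ans (s : Mem C) (l) :
    Function.update s.stack .ans l = stack { s with ans := l } := by
  funext k; cases k <;> rfl

/-- The memory with `n` ticks added to the output. -/
abbrev ticks (s : Mem C) (n : ℕ) : Mem C :=
  { s with out := List.replicate n .tick ++ s.out }

end Mem

/-- `Does P s s' n`: `P` turns the memory `s` into `s'` in at most `n` steps. -/
abbrev Does {C : Type} (P : Prog (Alphabet C)) (s s' : Mem C) (n : ℕ) : Prop :=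
  Runs P s.stack s'.stack n

/-- `Loops P s s' n`: a run of `P` from `s` may be obtained from a run from `s'` at the cost of at
most `n` additional steps. -/
abbrev Loops {C : Type} (P : Prog (Alphabet C)) (s s' : Mem C) (n : ℕ) : Prop :=
  Iter P s.stack s'.stack n

theorem Does.to {C : Type} {P : Prog (Alphabet C)} {s t s' : Mem C} {m n : ℕ} (h : Does P s t m)
    (e : t = s') (hmn : m ≤ n) : Does P s s' n :=
  e ▸ h.mono hmn

theorem Loops.to {C : Type} {P : Prog (Alphabet C)} {s t s' : Mem C} {m n : ℕ}
    (h : Loops P s t m) (e : t = s') (hmn : m ≤ n) : Loops P s s' n :=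
  e ▸ h.mono hmn

/-! ### Unary counter arithmetic -/

section counters

variable {C : Type}

theorem does_inc (i : Num) (s : Mem C) :
    Does (push (.num i) ()) s { s with num := Function.update s.num i (s.num i + 1) } 1 := by
  have := runs_push (Γ := Alphabet C) (.num i) () s.stack
  have e : (() :: s.stack (.num i)) = List.replicate (s.num i + 1) () := rfl
  rwa [e, Mem.update_num] at this

/-- Empty the counter `i`, and run `P` for each unit. -/
abbrev repeatNum (i : Num) (P : Prog (Alphabet C)) : Prog (Alphabet C) :=
  forEach (.num i) fun _ => P

theorem does_repeatNum_zero {i : Num} {P : Prog (Alphabet C)} {s : Mem C} (h : s.num i = 0) :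
    Does (repeatNum i P) s s 2 :=
  runs_forEach_nil (by simp [Mem.stack, h])

theorem loops_repeatNum {i : Num} {P : Prog (Alphabet C)} {s s' : Mem C} {n k : ℕ}
    (h : s.num i = n + 1) (hP : Does P { s with num := Function.update s.num i n } s' k) :
    Loops (repeatNum i P) s s' (k + 1) := by
  refine iter_forEach (a := ()) (l := List.replicate n ())
    (by simp [Mem.stack, h, List.replicate_succ]) ?_
  rw [Mem.update_num]
  exact hP

/-- Add the counter `i` to `j`, and make `i` zero. -/
abbrev moveNum (i j : Num) : Prog (Alphabet C) := repeatNum i (push (.num j) ())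

theorem does_moveNum {i j : Num} (hij : i ≠ j) (s : Mem C) :
    Does (moveNum i j) s
      { s with num := Function.update (Function.update s.num i 0) j (s.num j + s.num i) }
      (2 * s.num i + 2) := by
  generalize h : s.num i = n
  induction n generalizing s with
  | zero =>
    have : Function.update (Function.update s.num i 0) j (s.num j + 0) = s.num := by
      simp [← h]
    rw [this]
    exact does_repeatNum_zero h
  | succ n ih =>
    refine Does.to (loops_repeatNum h (does_inc j _) _ _ (ih _ (by simp [hij]))) ?_ (by omega)
    simp only [Mem.mk.injEq, and_true]
    funext k
    by_cases h₁ : k = j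
    · subst h₁; simp [Ne.symm hij]; omega
    · by_cases h₂ : k = i
      · subst h₂; simp [h₁]
      · simp [h₁, h₂]

/-- Run `P` as often as the counter `i` says, using `j` to restore `i` afterwards. -/
abbrev forNum (i j : Num) (P : Prog (Alphabet C)) : Prog (Alphabet C) :=
  repeatNum i (push (.num j) () ;; P) ;; moveNum j i

/-- The invariant permits nesting: the body may depend on further counters, provided that the
changes to `i` and `j` during the loop leave the invariant intact. Nested loops of this kind
multiply counters. -/
theorem does_forNum_ticks {i j : Num} (hij : i ≠ j) {P : Prog (Alphabet C)} {k b : ℕ}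
    (inv : (Num → ℕ) → Prop)
    (hinv : ∀ f m n, inv f → inv (Function.update (Function.update f i m) j n))
    (hP : ∀ s : Mem C, inv s.num → Does P s (s.ticks k) b)
    (s : Mem C) (hs : inv s.num) (hj : s.num j = 0) :
    Does (forNum i j P) s (s.ticks (s.num i * k)) (s.num i * (b + 4) + 4) := by
  have key : ∀ n (s : Mem C), inv s.num → s.num i = n →
      Does (repeatNum i (push (.num j) () ;; P)) s
        { s.ticks (n * k) with
          num := Function.update (Function.update s.num i 0) j (s.num j + n) }
        (n * (b + 2) + 2) := by
    intro n
    induction n with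
    | zero =>
      intro s hs h
      have : Function.update (Function.update s.num i 0) j (s.num j + 0) = s.num := by
        simp [← h]
      rw [this]
      simpa [Mem.ticks] using does_repeatNum_zero h
    | succ n ih =>
      intro s hs h
      refine Does.to (loops_repeatNum h ((does_inc j _).seq (hP _ (hinv _ _ _ hs))) _ _
        (ih _ (hinv _ _ _ hs) (by simp [hij]))) ?_ (by ring_nf; omega)
      simp only [Mem.mk.injEq, and_true, true_and]
      constructor
      · funext l
        by_cases h₁ : l = j
        · subst h₁; simp [Ne.symm hij]; omega
        · by_cases h₂ : l = i
          · subst h₂; simp [h₁]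
          · simp [h₁, h₂]
      · rw [← List.append_assoc, List.replicate_append_replicate]
        congr 2
        ring
  refine Does.to ((key _ s hs rfl).seq (does_moveNum (Ne.symm hij) _)) ?_
    (by simp [hj]; ring_nf; omega)
  simp only [Mem.ticks, Mem.mk.injEq, and_true]
  funext l
  by_cases h₁ : l = i
  · subst h₁; simp [hij, hj]
  · by_cases h₂ : l = j
    · subst h₂; simp [h₁, hj]
    · simp [h₁, h₂]

end counters

end LatticeRefutability

namespace LatticeRefutability

open Prog

/-! ### Writing ring terms -/

/-- Ring terms with variables that are indexed by pairs of counters. -/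
inductive Template : Type
  | pair (i j : Num) : Template
  | one : Template
  | add (t s : Template) : Template
  | sub (t s : Template) : Template
  | mul (t s : Template) : Template

namespace Template

/-- The ring term that arises from given values of the counters; the value of `cnt` serves to code
pairs of numbers. -/
def inst (num : Num → ℕ) : Template → RingTerm
  | pair i j => .var (num i * num .cnt + num j)
  | one => .one
  | add t s => .add (t.inst num) (s.inst num)
  | sub t s => .sub (t.inst num) (s.inst num)
  | mul t s => .mul (t.inst num) (s.inst num)

/-- The number of symbols of a template. -/
def size : Template → ℕ
  | pair _ _ => 1
  | one => 1
  | add t s | sub t s | mul t s => t.size + s.size + 1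

/-- The template does not use the counters that are needed for writing it. -/
def Proper : Template → Prop
  | pair i j => i ≠ .cnt ∧ i ≠ .aux₁ ∧ i ≠ .aux₂ ∧ j ≠ .cnt ∧ j ≠ .aux₁ ∧ j ≠ .aux₂
  | one => True
  | add t s | sub t s | mul t s => t.Proper ∧ s.Proper

variable {C : Type}

/-- Put the ring term given by a template in front of the output. -/
def write : Template → Prog (Alphabet C)
  | pair i j => push .out .var ;; forNum j .aux₁ (push .out .tick) ;;
      forNum i .aux₁ (forNum .cnt .aux₂ (push .out .tick))
  | one => push .out .one
  | add t s => s.write ;; t.write ;; push .out .add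
  | sub t s => s.write ;; t.write ;; push .out .sub
  | mul t s => s.write ;; t.write ;; push .out .mul

end Template

variable {C : Type}

theorem does_push_out (a : RingSymbol) (s : Mem C) :
    Does (push .out a) s { s with out := a :: s.out } 1 := by
  have := runs_push (Γ := Alphabet C) .out a s.stack
  rwa [Mem.update_out] at this

/-- The output grows at its front, so the closing symbol comes first and the ticks follow. The
product of `i` and `cnt` is produced by two nested loops, with `aux₁` restoring the outer counter
and `aux₂` the inner one. -/
theorem does_write_pair {i j : Num} (h : (Template.pair i j).Proper) (s : Mem C)
    (h₁ : s.num .aux₁ = 0) (h₂ : s.num .aux₂ = 0) {L : ℕ} (hL : ∀ i, s.num i ≤ L) :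
    Does (Template.pair i j).write s
      { s with out := ((Template.pair i j).inst s.num).encode ++ s.out } (13 * (L + 1) ^ 2) := by
  obtain ⟨hi, hi₁, hi₂, hj, hj₁, hj₂⟩ := h
  have tick : ∀ s : Mem C, Does (push .out .tick) s (s.ticks 1) 1 := does_push_out _
  have e₁ := does_push_out .var s
  have e₂ := does_forNum_ticks hj₁ (fun _ => True) (fun _ _ _ _ => trivial)
    (fun s _ => tick s) { s with out := .var :: s.out } trivial h₁
  have e₃ := fun (s : Mem C) (h₂ : s.num .aux₂ = 0) =>
    does_forNum_ticks (i := .cnt) (j := .aux₂) (by decide) (fun _ => True)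
      (fun _ _ _ _ => trivial) (fun s _ => tick s) s trivial h₂
  -- The invariant of the outer loop is what the inner loop relies on: `cnt` has its original value
  -- and `aux₂` is empty.
  have e₄ := fun (s' : Mem C) (h : s'.num = s.num) =>
    does_forNum_ticks (C := C) hi₁ (P := forNum .cnt .aux₂ (push .out .tick))
    (k := s.num .cnt * 1) (b := s.num .cnt * (1 + 4) + 4)
    (fun f => f .cnt = s.num .cnt ∧ f .aux₂ = 0)
    (fun f m n hf => by simp [hi.symm, hi₂.symm, hf])
    (fun s hs => by rw [← hs.1]; exact e₃ s hs.2) s' (by simp [h, h₂]) (by simp [h, h₁])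
  refine Does.to (e₁.seq (e₂.seq (e₄ _ rfl))) ?_ ?_
  · simp only [Mem.mk.injEq, and_true, true_and, Template.inst, RingTerm.encode]
    rw [← List.append_assoc, List.replicate_append_replicate]
    simp
  · have hi := hL i
    have hj := hL j
    have hc := hL .cnt
    have : s.num i * s.num .cnt ≤ L * L := Nat.mul_le_mul hi hc
    simp only
    nlinarith

theorem does_write (τ : Template) (h : τ.Proper) (s : Mem C)
    (h₁ : s.num .aux₁ = 0) (h₂ : s.num .aux₂ = 0) {L : ℕ} (hL : ∀ i, s.num i ≤ L) :
    Does τ.write s { s with out := (τ.inst s.num).encode ++ s.out }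
      (τ.size * (13 * (L + 1) ^ 2)) := by
  have hpos : 1 ≤ 13 * (L + 1) ^ 2 := by have := Nat.one_le_pow 2 (L + 1) (by omega); omega
  induction τ generalizing s with
  | pair i j => simpa [Template.size] using does_write_pair h s h₁ h₂ hL
  | one => exact (does_push_out .one s).mono (by simpa [Template.size] using hpos)
  | add t r iht ihr | sub t r iht ihr | mul t r iht ihr =>
    refine Does.to ((ihr h.2 s h₁ h₂ hL).seq ((iht h.1
      { s with out := (r.inst s.num).encode ++ s.out } h₁ h₂ hL).seq (does_push_out _ _))) ?_ ?_
    · simp [Template.inst, RingTerm.encode]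
    · simp only [Template.size]
      nlinarith

/-- Put the ring terms given by a list of templates in front of the output. -/
def writeAll : List Template → Prog (Alphabet C)
  | [] => skip
  | τ :: l => writeAll l ;; τ.write

theorem does_writeAll (l : List Template) (h : ∀ τ ∈ l, τ.Proper) (s : Mem C)
    (h₁ : s.num .aux₁ = 0) (h₂ : s.num .aux₂ = 0) {L : ℕ} (hL : ∀ i, s.num i ≤ L) :
    Does (writeAll l) s
      { s with out := RingTerm.encodeList (l.map (Template.inst s.num)) ++ s.out }
      (((l.map Template.size).sum + 1) * (13 * (L + 1) ^ 2)) := by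
  have hpos : 1 ≤ 13 * (L + 1) ^ 2 := by have := Nat.one_le_pow 2 (L + 1) (by omega); omega
  induction l with
  | nil => exact (runs_skip _).mono (by simpa using hpos)
  | cons τ l ih =>
    refine Does.to ((ih fun τ hτ => h τ (by simp [hτ])).seq
      (does_write τ (h τ (by simp))
        { s with out := RingTerm.encodeList (l.map (Template.inst s.num)) ++ s.out } h₁ h₂ hL))
      ?_ ?_
    · simp [RingTerm.encodeList]
    · simp only [List.map_cons, List.sum_cons]
      nlinarith

/-! ### Nodes and their equations -/

/-- A node of a lattice term: the operation, the name `y` of the node and, for a join or a meet,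
the names `x, z` of the two arguments. At a variable, `x` is its index. -/
structure Node : Type where
  op : NodeOp
  x : ℕ
  y : ℕ
  z : ℕ

/-- A node as a word. -/
def Node.word (R : Node) : List NodeSymbol :=
  List.replicate R.x .tick ++ .sep₁ :: (List.replicate R.y .tick ++
    .sep₂ :: (List.replicate R.z .tick ++ [.op R.op]))

theorem Node.length_word (R : Node) : R.word.length = R.x + R.y + R.z + 3 := by
  simp [word]; omega

/-- The equations for the row of a node. -/
def rowEqs : NodeOp → List Template
  -- Entries at variable indices serve as an equality test: the diagonal one is forced to be 1.
  -- Together with `varEqs` this spares the machine any comparison of indices.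
  | .var => [.sub (.pair .x₁ .x₁) .one]
  | .zero => [.pair .y₁ .y₂]
  | .one => []
  | .join => [.sub (.pair .y₁ .y₂) (.add (.pair .x₁ .y₂) (.pair .z₁ .y₂))]
  | .meet => [.sub (.pair .y₁ .y₂) (.pair .x₁ .y₂), .sub (.pair .y₁ .y₂) (.pair .z₁ .y₂)]

/-- The equations for the column of a node. -/
def colEqs : NodeOp → List Template
  | .var => []
  | .zero => []
  -- Columns stand for functionals that vanish on the value of the node, so the operations act
  -- dually: zero at the top, equality at a join, a sum at a meet.
  | .one => [.pair .y₁ .y₂]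
  | .join => [.sub (.pair .y₁ .y₂) (.pair .y₁ .x₂), .sub (.pair .y₁ .y₂) (.pair .y₁ .z₂)]
  | .meet => [.sub (.pair .y₁ .y₂) (.add (.pair .y₁ .x₂) (.pair .y₁ .z₂))]

/-- The equation for a row and a column both of which belong to variables. -/
def varEqs : NodeOp → NodeOp → List Template
  -- For equal variables the second factor is 1 and the entry of the two leaves must vanish; for
  -- different ones the second factor may be chosen to be 0.
  | .var, .var => [.mul (.pair .y₁ .y₂) (.pair .x₁ .x₂)]
  | _, _ => []

/-- The equations for the row of one node and the column of another. -/
def pairEqs (o o' : NodeOp) : List Template := rowEqs o ++ colEqs o' ++ varEqs o o'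

theorem pairEqs_proper (o o' : NodeOp) : ∀ τ ∈ pairEqs o o', τ.Proper := by
  cases o <;> cases o' <;> simp [pairEqs, rowEqs, colEqs, varEqs, Template.Proper]

/-- Only the existence of a uniform bound matters: the cost of one pair of nodes is a constant times
the square of the largest counter. -/
theorem pairEqs_size (o o' : NodeOp) : ((pairEqs o o').map Template.size).sum ≤ 15 := by
  cases o <;> cases o' <;> simp [pairEqs, rowEqs, colEqs, varEqs, Template.size]

/-- Values of the counters. -/
def regs (m x y z x' y' z' : ℕ) : Num → ℕ
  | .cnt => m
  | .x₁ => x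
  | .y₁ => y
  | .z₁ => z
  | .x₂ => x'
  | .y₂ => y'
  | .z₂ => z'
  | _ => 0

section regs

variable (m x y z x' y' z' n : ℕ)

theorem regs_cnt : Function.update (regs m x y z x' y' z') .cnt n = regs n x y z x' y' z' := by
  funext i; cases i <;> rfl
theorem regs_x₁ : Function.update (regs m x y z x' y' z') .x₁ n = regs m n y z x' y' z' := by
  funext i; cases i <;> rfl
theorem regs_y₁ : Function.update (regs m x y z x' y' z') .y₁ n = regs m x n z x' y' z' := by
  funext i; cases i <;> rfl
theorem regs_z₁ : Function.update (regs m x y z x' y' z') .z₁ n = regs m x y n x' y' z' := by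
  funext i; cases i <;> rfl
theorem regs_x₂ : Function.update (regs m x y z x' y' z') .x₂ n = regs m x y z n y' z' := by
  funext i; cases i <;> rfl
theorem regs_y₂ : Function.update (regs m x y z x' y' z') .y₂ n = regs m x y z x' n z' := by
  funext i; cases i <;> rfl
theorem regs_z₂ : Function.update (regs m x y z x' y' z') .z₂ n = regs m x y z x' y' n := by
  funext i; cases i <;> rfl

theorem regs_le {m x y z x' y' z' L : ℕ} (hm : m ≤ L) (hx : x ≤ L) (hy : y ≤ L) (hz : z ≤ L)
    (hx' : x' ≤ L) (hy' : y' ≤ L) (hz' : z' ≤ L) (i : Num) : regs m x y z x' y' z' i ≤ L := by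
  cases i <;> simp [regs, *]

end regs

/-- The ring terms for the row of one node and the column of another. -/
def nodeEqs (m : ℕ) (R R' : Node) : List RingTerm :=
  (pairEqs R.op R'.op).map (Template.inst (regs m R.x R.y R.z R'.x R'.y R'.z))

end LatticeRefutability

namespace LatticeRefutability

open Prog

variable {C : Type} {w : List C}

/-! ### The equations for all pairs of nodes -/

/-- Process one symbol of the list of nodes for the columns. -/
def columnStep (o : NodeOp) : NodeSymbol → Prog (Alphabet C)
  | .tick => push (.num .z₂) ()
  | .sep₁ => moveNum .z₂ .x₂
  | .sep₂ => moveNum .z₂ .y₂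
  | .op o' => writeAll (pairEqs o o') ;; clear (.num .x₂) ;; clear (.num .y₂) ;; clear (.num .z₂)

/-- Write the equations for a given row and all columns. -/
def columns (o : NodeOp) : Prog (Alphabet C) :=
  forEach .log' (fun a => push .bak a ;; columnStep o a) ;; drain .bak .log' id

theorem does_push_bak (a : NodeSymbol) (s : Mem C) :
    Does (push .bak a) s { s with bak := a :: s.bak } 1 := by
  have := runs_push (Γ := Alphabet C) .bak a s.stack
  rwa [Mem.update_bak] at this

theorem does_clear_num (i : Num) (s : Mem C) :
    Does (clear (.num i)) s { s with num := Function.update s.num i 0 } (2 * s.num i + 2) := by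
  have := runs_clear (Γ := Alphabet C) (.num i) s.stack
  have e : ([] : List Unit) = List.replicate 0 () := rfl
  rw [e, Mem.update_num] at this
  simpa using this

theorem loops_log' {f : NodeSymbol → Prog (Alphabet C)} {a : NodeSymbol} {s s' : Mem C}
    {l : List NodeSymbol} {n : ℕ} (h : s.log' = a :: l)
    (hf : Does (f a) { s with log' := l } s' n) : Loops (forEach .log' f) s s' (n + 1) := by
  refine iter_forEach (Γ := Alphabet C) (a := a) (l := l) h ?_
  rw [Mem.update_log']
  exact hf

/-- The memory while the equations for pairs of nodes are being written. -/
def pairMem (w : List C) (num : Num → ℕ) (log log' bak : List NodeSymbol)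
    (out : List RingSymbol) : Mem C :=
  { num := num, log := log, log' := log', bak := bak, out := out, todo := w }

/-! ### One row against all columns -/

section columns

variable (o : NodeOp) (m x y z x' y' z' : ℕ) (log l bak : List NodeSymbol) (out : List RingSymbol)

theorem loops_column {a : NodeSymbol} {f g : Num → ℕ} {out' : List RingSymbol} {n : ℕ}
    (h : Does (C := C) (columnStep o a) (pairMem w f log l (a :: bak) out)
      (pairMem w g log l (a :: bak) out') n) :
    Loops (C := C) (forEach .log' (fun a => push .bak a ;; columnStep o a))
      (pairMem w f log (a :: l) bak out) (pairMem w g log l (a :: bak) out') (n + 2) :=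
  (loops_log' (s := pairMem w f log (a :: l) bak out) rfl ((does_push_bak a _).seq h)).mono
    (by omega)

theorem loops_column_ticks (n : ℕ) :
    Loops (C := C) (forEach .log' (fun a => push .bak a ;; columnStep o a))
      (pairMem w (regs m x y z x' y' z') log (List.replicate n .tick ++ l) bak out)
      (pairMem w (regs m x y z x' y' (z' + n)) log l (List.replicate n .tick ++ bak) out)
      (3 * n) := by
  induction n generalizing bak z' with
  | zero => exact Iter.refl _ _
  | succ n ih =>
    have h₁ : Does (C := C) (columnStep o .tick)
        (pairMem w (regs m x y z x' y' z') log (List.replicate n .tick ++ l) (.tick :: bak) out)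
        (pairMem w (regs m x y z x' y' (z' + 1)) log (List.replicate n .tick ++ l)
          (.tick :: bak) out) 1 :=
      Does.to (does_inc .z₂ _) (by simp [pairMem, regs_z₂]; rfl) le_rfl
    refine Loops.to ((loops_column o _ _ _ _ h₁).trans (ih (z' + 1) (.tick :: bak))) ?_
      (by omega)
    rw [List.append_cons, ← List.replicate_succ', Nat.add_right_comm, Nat.add_assoc]

/-- Ticks always collect in `z₂`, and a separator moves them to the field that they belong to. What
comes after the last separator stays in `z₂`. -/
theorem loops_column_sep₁ :
    Loops (C := C) (forEach .log' (fun a => push .bak a ;; columnStep o a))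
      (pairMem w (regs m x y z 0 y' z') log (.sep₁ :: l) bak out)
      (pairMem w (regs m x y z z' y' 0) log l (.sep₁ :: bak) out) (2 * z' + 4) := by
  refine loops_column o _ _ _ _ (Does.to (does_moveNum (by decide) _) ?_ le_rfl)
  simp [pairMem, regs_z₂, regs_x₂, regs]

theorem loops_column_sep₂ :
    Loops (C := C) (forEach .log' (fun a => push .bak a ;; columnStep o a))
      (pairMem w (regs m x y z x' 0 z') log (.sep₂ :: l) bak out)
      (pairMem w (regs m x y z x' z' 0) log l (.sep₂ :: bak) out) (2 * z' + 4) := by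
  refine loops_column o _ _ _ _ (Does.to (does_moveNum (by decide) _) ?_ le_rfl)
  simp [pairMem, regs_z₂, regs_y₂, regs]

theorem loops_column_op (o' : NodeOp) (hx : x ≤ m) (hy : y ≤ m) (hz : z ≤ m) (hx' : x' ≤ m)
    (hy' : y' ≤ m) (hz' : z' ≤ m) :
    Loops (C := C) (forEach .log' (fun a => push .bak a ;; columnStep o a))
      (pairMem w (regs m x y z x' y' z') log (.op o' :: l) bak out)
      (pairMem w (regs m x y z 0 0 0) log l (.op o' :: bak)
        (RingTerm.encodeList (nodeEqs m ⟨o, x, y, z⟩ ⟨o', x', y', z'⟩) ++ out))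
      (216 * (m + 1) ^ 2) := by
  have h₁ := does_writeAll (C := C) (pairEqs o o') (pairEqs_proper o o')
    (pairMem w (regs m x y z x' y' z') log l (.op o' :: bak) out) rfl rfl
    (regs_le le_rfl hx hy hz hx' hy' hz')
  have h₂ : Does (C := C) (columnStep o (.op o'))
      (pairMem w (regs m x y z x' y' z') log l (.op o' :: bak) out)
      (pairMem w (regs m x y z 0 0 0) log l (.op o' :: bak)
        (RingTerm.encodeList (nodeEqs m ⟨o, x, y, z⟩ ⟨o', x', y', z'⟩) ++ out)) _ :=
    Does.to (h₁.seq ((does_clear_num .x₂ _).seq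
      ((does_clear_num .y₂ _).seq (does_clear_num .z₂ _))))
      (by simp [pairMem, regs_z₂, regs_y₂, regs_x₂, nodeEqs]) le_rfl
  refine (loops_column o _ _ _ _ h₂).mono ?_
  -- Writing costs at most 16 · 13 = 208 times the square; the remaining 8 cover the three clearings
  -- and the loop overhead.
  · have h := Nat.mul_le_mul_right (13 * (m + 1) ^ 2)
      (Nat.add_le_add_right (pairEqs_size o o') 1)
    simp [pairMem, regs]
    nlinarith

theorem loops_columns_node (R R' : Node) (hx : R.x ≤ m) (hy : R.y ≤ m) (hz : R.z ≤ m)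
    (hx' : R'.x ≤ m) (hy' : R'.y ≤ m) (hz' : R'.z ≤ m) :
    Loops (C := C) (forEach .log' (fun a => push .bak a ;; columnStep R.op a))
      (pairMem w (regs m R.x R.y R.z 0 0 0) log (R'.word ++ l) bak out)
      (pairMem w (regs m R.x R.y R.z 0 0 0) log l (R'.word.reverse ++ bak)
        (RingTerm.encodeList (nodeEqs m R R') ++ out))
      (240 * (m + 1) ^ 2) := by
  have e : R'.word ++ l = List.replicate R'.x .tick ++ (.sep₁ :: (List.replicate R'.y .tick ++
      (.sep₂ :: (List.replicate R'.z .tick ++ (.op R'.op :: l))))) := by simp [Node.word]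
  rw [e]
  refine Loops.to ((loops_column_ticks _ _ _ _ _ _ _ _ _ _ _ _ _).trans
    ((loops_column_sep₁ _ _ _ _ _ _ _ _ _ _ _).trans
    ((loops_column_ticks _ _ _ _ _ _ _ _ _ _ _ _ _).trans
    ((loops_column_sep₂ _ _ _ _ _ _ _ _ _ _ _).trans
    ((loops_column_ticks _ _ _ _ _ _ _ _ _ _ _ _ _).trans
    (loops_column_op _ _ _ _ _ _ _ _ _ _ _ _ _ hx hy hz ?_ ?_ ?_)))))) ?_ ?_
  · omega
  · omega
  · omega
  · simp [Node.word]
  · nlinarith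

end columns

/-- A list of nodes as a word. -/
def nodesWord (l : List Node) : List NodeSymbol := l.flatMap Node.word

/-- The numbers at a node are bounded by `m`. -/
def Node.Bounded (m : ℕ) (R : Node) : Prop := R.x ≤ m ∧ R.y ≤ m ∧ R.z ≤ m

theorem length_nodesWord_le {m : ℕ} {l : List Node} (h : ∀ R ∈ l, R.Bounded m) :
    (nodesWord l).length ≤ l.length * (3 * m + 3) := by
  induction l with
  | nil => simp [nodesWord]
  | cons R l ih =>
    have h₁ := h R (by simp)
    have h₂ := ih fun R hR => h R (by simp [hR])
    simp only [nodesWord, List.flatMap_cons, List.length_append, R.length_word,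
      List.length_cons] at h₂ ⊢
    obtain ⟨_, _, _⟩ := h₁
    nlinarith

/-- The equations for the row of `R` and the columns of the nodes in `l`. -/
def rowNodeEqs (m : ℕ) (l : List Node) (R : Node) : List RingTerm :=
  l.reverse.flatMap (nodeEqs m R)

/-- The equations of a later node are put in front of those of an earlier one, which is why
`rowNodeEqs` reverses the list. -/
theorem loops_columns_nodes {m : ℕ} (log bak : List NodeSymbol) (R : Node)
    (hR : R.Bounded m) (l : List Node) (hl : ∀ R ∈ l, R.Bounded m) (out : List RingSymbol) :
    Loops (C := C) (forEach .log' (fun a => push .bak a ;; columnStep R.op a))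
      (pairMem w (regs m R.x R.y R.z 0 0 0) log (nodesWord l) bak out)
      (pairMem w (regs m R.x R.y R.z 0 0 0) log [] ((nodesWord l).reverse ++ bak)
        (RingTerm.encodeList (rowNodeEqs m l R) ++ out))
      (l.length * (240 * (m + 1) ^ 2)) := by
  induction l generalizing bak out with
  | nil => exact (Iter.refl _ _).mono (by simp)
  | cons R' l ih =>
    obtain ⟨hx, hy, hz⟩ := hR
    obtain ⟨hx', hy', hz'⟩ := hl R' (by simp)
    refine Loops.to ((loops_columns_node m log (nodesWord l) bak out R R' hx hy hz hx' hy'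
      hz').trans
      (ih _ (fun R hR => hl R (by simp [hR])) _)) ?_ ?_
    · simp [nodesWord, rowNodeEqs, RingTerm.encodeList]
    · simp only [List.length_cons]; nlinarith

/-- The pass leaves the reversed word on `bak`. Draining it reverses once more, so `log'` is intact
for the next row. -/
theorem does_columns {m : ℕ} (log : List NodeSymbol) (R : Node) (hR : R.Bounded m) (l : List Node)
    (hl : ∀ R ∈ l, R.Bounded m) (out : List RingSymbol) :
    Does (C := C) (columns R.op)
      (pairMem w (regs m R.x R.y R.z 0 0 0) log (nodesWord l) [] out)
      (pairMem w (regs m R.x R.y R.z 0 0 0) log (nodesWord l) []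
        (RingTerm.encodeList (rowNodeEqs m l R) ++ out))
      ((l.length + 1) * (250 * (m + 1) ^ 2)) := by
  have h₁ := loops_columns_nodes (C := C) (w := w) log [] R hR l hl out _ _ (runs_forEach_nil rfl)
  have h₂ := runs_drain (Γ := Alphabet C) (k := .bak) (k' := .log') (by decide) id
    (pairMem w (regs m R.x R.y R.z 0 0 0) log [] ((nodesWord l).reverse ++ [])
        (RingTerm.encodeList (rowNodeEqs m l R) ++ out)).stack
  rw [Mem.update_bak, Mem.update_log'] at h₂
  refine Does.to (h₁.seq h₂) ?_ ?_
  · simp [pairMem, Mem.stack]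
  · have := length_nodesWord_le hl
    simp [pairMem, Mem.stack]
    nlinarith

/-- Process one symbol of the list of nodes for the rows. -/
def rowStep : NodeSymbol → Prog (Alphabet C)
  | .tick => push (.num .z₁) ()
  | .sep₁ => moveNum .z₁ .x₁
  | .sep₂ => moveNum .z₁ .y₁
  | .op o => columns o ;; clear (.num .x₁) ;; clear (.num .y₁) ;; clear (.num .z₁)

theorem loops_log {f : NodeSymbol → Prog (Alphabet C)} {a : NodeSymbol} {s s' : Mem C}
    {l : List NodeSymbol} {n : ℕ} (h : s.log = a :: l)
    (hf : Does (f a) { s with log := l } s' n) : Loops (forEach .log f) s s' (n + 1) := by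
  refine iter_forEach (Γ := Alphabet C) (a := a) (l := l) h ?_
  rw [Mem.update_log]
  exact hf

/-! ### All rows -/

section rows

variable (m x y z : ℕ) (l log' : List NodeSymbol) (out : List RingSymbol)

theorem loops_row {a : NodeSymbol} {f g : Num → ℕ} {out' : List RingSymbol} {n : ℕ}
    (h : Does (C := C) (rowStep a) (pairMem w f l log' [] out) (pairMem w g l log' [] out') n) :
    Loops (C := C) (forEach .log rowStep)
      (pairMem w f (a :: l) log' [] out) (pairMem w g l log' [] out') (n + 1) :=
  loops_log (s := pairMem w f (a :: l) log' [] out) rfl h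

theorem loops_row_ticks (n : ℕ) :
    Loops (C := C) (forEach .log rowStep)
      (pairMem w (regs m x y z 0 0 0) (List.replicate n .tick ++ l) log' [] out)
      (pairMem w (regs m x y (z + n) 0 0 0) l log' [] out) (2 * n) := by
  induction n generalizing z with
  | zero => exact Iter.refl _ _
  | succ n ih =>
    have h₁ : Does (C := C) (rowStep .tick)
        (pairMem w (regs m x y z 0 0 0) (List.replicate n .tick ++ l) log' [] out)
        (pairMem w (regs m x y (z + 1) 0 0 0) (List.replicate n .tick ++ l) log' [] out) 1 :=
      Does.to (does_inc .z₁ _) (by simp [pairMem, regs_z₁]; rfl) le_rfl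
    refine Loops.to ((loops_row _ _ _ h₁).trans (ih (z + 1))) ?_ (by omega)
    rw [Nat.add_right_comm, Nat.add_assoc]

theorem loops_row_sep₁ :
    Loops (C := C) (forEach .log rowStep)
      (pairMem w (regs m 0 y z 0 0 0) (.sep₁ :: l) log' [] out)
      (pairMem w (regs m z y 0 0 0 0) l log' [] out) (2 * z + 3) := by
  refine loops_row _ _ _ (Does.to (does_moveNum (by decide) _) ?_ le_rfl)
  simp [pairMem, regs_z₁, regs_x₁, regs]

theorem loops_row_sep₂ :
    Loops (C := C) (forEach .log rowStep)
      (pairMem w (regs m x 0 z 0 0 0) (.sep₂ :: l) log' [] out)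
      (pairMem w (regs m x z 0 0 0 0) l log' [] out) (2 * z + 3) := by
  refine loops_row _ _ _ (Does.to (does_moveNum (by decide) _) ?_ le_rfl)
  simp [pairMem, regs_z₁, regs_y₁, regs]

theorem loops_rows_node (R : Node) (hR : R.Bounded m) (N : List Node)
    (hN : ∀ R ∈ N, R.Bounded m) :
    Loops (C := C) (forEach .log rowStep)
      (pairMem w (regs m 0 0 0 0 0 0) (R.word ++ l) (nodesWord N) [] out)
      (pairMem w (regs m 0 0 0 0 0 0) l (nodesWord N) []
        (RingTerm.encodeList (rowNodeEqs m N R) ++ out))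
      ((N.length + 1) * (300 * (m + 1) ^ 2)) := by
  have e : R.word ++ l = List.replicate R.x .tick ++ (.sep₁ :: (List.replicate R.y .tick ++
      (.sep₂ :: (List.replicate R.z .tick ++ (.op R.op :: l))))) := by simp [Node.word]
  rw [e]
  have h₁ : Does (C := C) (rowStep (.op R.op))
      (pairMem w (regs m R.x R.y R.z 0 0 0) l (nodesWord N) [] out)
      (pairMem w (regs m 0 0 0 0 0 0) l (nodesWord N) []
        (RingTerm.encodeList (rowNodeEqs m N R) ++ out)) _ :=
    Does.to ((does_columns l R hR N hN out).seq ((does_clear_num .x₁ _).seq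
      ((does_clear_num .y₁ _).seq (does_clear_num .z₁ _))))
      (by simp [pairMem, regs_z₁, regs_y₁, regs_x₁]) le_rfl
  have h₂ := fun x y z l =>
    (Nat.zero_add z) ▸ loops_row_ticks (C := C) (w := w) m x y 0 l (nodesWord N) out z
  refine ((h₂ _ _ _ _).trans ((loops_row_sep₁ _ _ _ _ _ _).trans ((h₂ _ _ _ _).trans
    ((loops_row_sep₂ _ _ _ _ _ _).trans ((h₂ _ _ _ _).trans (loops_row _ _ _ h₁)))))).mono ?_
  obtain ⟨hx, hy, hz⟩ := hR
  simp [pairMem, regs]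
  nlinarith

theorem loops_rows_nodes (N : List Node) (hN : ∀ R ∈ N, R.Bounded m) (L : List Node)
    (hL : ∀ R ∈ L, R.Bounded m) :
    Loops (C := C) (forEach .log rowStep)
      (pairMem w (regs m 0 0 0 0 0 0) (nodesWord L) (nodesWord N) [] out)
      (pairMem w (regs m 0 0 0 0 0 0) [] (nodesWord N) []
        (RingTerm.encodeList (L.reverse.flatMap (rowNodeEqs m N)) ++ out))
      (L.length * ((N.length + 1) * (300 * (m + 1) ^ 2))) := by
  induction L generalizing out with
  | nil => exact (Iter.refl _ _).mono (by simp)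
  | cons R L ih =>
    refine Loops.to ((loops_rows_node m (nodesWord L) out R (hL R (by simp)) N hN).trans
      (ih _ (fun R hR => hL R (by simp [hR])))) ?_ ?_
    · simp [nodesWord, RingTerm.encodeList]
    · simp only [List.length_cons]; nlinarith

end rows

end LatticeRefutability

namespace LatticeRefutability

open Prog

/-! ### The equations for a pair of lattice terms -/

namespace BLatTerm

/-- One less than the number of nodes of a term. -/
def ops : BLatTerm → ℕ
  | var _ | zero | one => 0
  | join t s | meet t s => t.ops + s.ops + 2

/-- The nodes of a term, with names `c, c + 1, …, c + t.ops`, the root being the last. -/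
def nodes : BLatTerm → ℕ → List Node
  | var n, c => [⟨.var, n, c, 0⟩]
  | zero, c => [⟨.zero, 0, c, 0⟩]
  | one, c => [⟨.one, 0, c, 0⟩]
  | join t s, c => ⟨.join, c + s.ops + 1 + t.ops, c + s.ops + 1 + t.ops + 1, c + s.ops⟩ ::
      (t.nodes (c + s.ops + 1) ++ s.nodes c)
  | meet t s, c => ⟨.meet, c + s.ops + 1 + t.ops, c + s.ops + 1 + t.ops + 1, c + s.ops⟩ ::
      (t.nodes (c + s.ops + 1) ++ s.nodes c)

/-- This keeps the number of nodes, and with it all names, linear in the length of the input. -/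
theorem ops_lt_length (t : BLatTerm) : t.ops < t.encode.length := by
  induction t <;> simp_all [ops, encode] <;> omega

theorem length_nodes (t : BLatTerm) : ∀ c, (t.nodes c).length = t.ops + 1 := by
  induction t <;> intro c <;> simp_all [ops, nodes] <;> omega

/-- The hypothesis on the length of the word is there for the leaves, where the field `x` is a
variable index and not a name. -/
theorem bounded_of_mem_nodes (t : BLatTerm) : ∀ {c m : ℕ} {R : Node}, R ∈ t.nodes c →
    t.encode.length ≤ c → c + t.ops ≤ m → R.Bounded m := by
  induction t with
  | var n | zero | one =>
    intro c m R hR hl hm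
    simp only [nodes, List.mem_singleton] at hR
    subst hR
    simp [encode, ops, Node.Bounded] at *
    omega
  | join t s iht ihs | meet t s iht ihs =>
    intro c m R hR hl hm
    simp only [nodes, List.mem_cons, List.mem_append, ops, encode, List.length_cons,
      List.length_append] at *
    obtain rfl | hR | hR := hR
    · simp only [Node.Bounded]; omega
    · exact iht hR (by omega) (by omega)
    · exact ihs hR (by omega) (by omega)

end BLatTerm

/-- The nodes of a pair of terms. -/
def pairNodes (e : BLatTerm × BLatTerm) (c : ℕ) : List Node :=
  e.1.nodes (c + e.2.ops + 1) ++ e.2.nodes c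

/-- The equation that makes one of two entries nonzero. -/
def rootTemplate : Template := .sub (.add (.pair .x₁ .x₂) (.pair .x₂ .x₁)) .one

/-- The equations for a pair of terms, with names of nodes that start at `c`. -/
def pairSystem (e : BLatTerm × BLatTerm) (c : ℕ) : List RingTerm :=
  (pairNodes e c).reverse.flatMap
      (rowNodeEqs (c + e.2.ops + 1 + e.1.ops + 1) (pairNodes e c)) ++
    [rootTemplate.inst (regs (c + e.2.ops + 1 + e.1.ops + 1)
      (c + e.2.ops + 1 + e.1.ops) 0 0 (c + e.2.ops) 0 0)]

variable {C : Type} {w : List C}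

/-! ### Parsing -/

/-- Write down a node with arguments `x₁`, `z₁` and a new name. -/
def newNode (o : NodeOp) : Prog (Alphabet C) :=
  push .log (.op o) ;; repeatNum .z₁ (push .log .tick) ;; push .log .sep₂ ;; push .names false ;;
  (repeatNum .cnt (push (.num .aux₁) () ;; push .log .tick ;; push .names true) ;;
    moveNum .aux₁ .cnt) ;;
  push (.num .cnt) () ;; push .log .sep₁ ;; repeatNum .x₁ (push .log .tick)

/-- Move a name to the counter `i`. -/
def popName (i : Num) : Prog (Alphabet C) :=
  loop .names (fun o => o == some true) fun o =>
    match o with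
    | some true => push (.num i) ()
    | _ => skip

/-- Process one symbol of the reversed word of a term. -/
def parseStep : LatSymbol → Prog (Alphabet C)
  | .tick => push .log .tick
  | .var => newNode .var
  | .zero => newNode .zero
  | .one => newNode .one
  | .join => popName .x₁ ;; popName .z₁ ;; newNode .join
  | .meet => popName .x₁ ;; popName .z₁ ;; newNode .meet

/-- The memory during parsing. -/
def parseMem (w : List C) (num : Num → ℕ) (rev : List LatSymbol) (log : List NodeSymbol)
    (names : List Bool) : Mem C :=
  { num := num, rev := rev, log := log, names := names, todo := w }

theorem does_push_log (a : NodeSymbol) (s : Mem C) :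
    Does (push .log a) s { s with log := a :: s.log } 1 := by
  have := runs_push (Γ := Alphabet C) .log a s.stack
  rwa [Mem.update_log] at this

theorem does_push_names (a : Bool) (s : Mem C) :
    Does (push .names a) s { s with names := a :: s.names } 1 := by
  have := runs_push (Γ := Alphabet C) .names a s.stack
  rwa [Mem.update_names] at this

theorem does_log_ticks (i : Num) (s : Mem C) :
    Does (repeatNum i (push .log .tick)) s
      { s with num := Function.update s.num i 0, log := List.replicate (s.num i) .tick ++ s.log }
      (2 * s.num i + 2) := by
  generalize h : s.num i = n
  induction n generalizing s with
  | zero =>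
    have : Function.update s.num i 0 = s.num := by simp [← h]
    rw [this]
    exact does_repeatNum_zero h
  | succ n ih =>
    refine Does.to (loops_repeatNum h (does_push_log .tick _) _ _ (ih _ (by simp))) ?_ (by omega)
    simp only [Mem.mk.injEq, true_and, and_true, Function.update_idem]
    rw [List.append_cons, ← List.replicate_succ']

theorem does_newName (c x z : ℕ) (rev : List LatSymbol) (log : List NodeSymbol)
    (names : List Bool) :
    Does (repeatNum .cnt (push (.num .aux₁) () ;; push .log .tick ;; push .names true) ;;
        moveNum .aux₁ .cnt)
      (parseMem w (regs c x 0 z 0 0 0) rev log names)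
      (parseMem w (regs c x 0 z 0 0 0) rev (List.replicate c .tick ++ log)
        (List.replicate c true ++ names)) (6 * c + 4) := by
  have key : ∀ n (s : Mem C), s.num .cnt = n →
      Does (repeatNum .cnt (push (.num .aux₁) () ;; push .log .tick ;; push .names true)) s
        { s with
          num := Function.update (Function.update s.num .cnt 0) .aux₁ (s.num .aux₁ + n)
          log := List.replicate n .tick ++ s.log
          names := List.replicate n true ++ s.names } (4 * n + 2) := by
    intro n
    induction n with
    | zero =>
      intro s h
      have : Function.update (Function.update s.num .cnt 0) .aux₁ (s.num .aux₁ + 0) = s.num := by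
        simp [← h]
      rw [this]
      exact does_repeatNum_zero h
    | succ n ih =>
      intro s h
      refine Does.to (loops_repeatNum h ((does_inc .aux₁ _).seq ((does_push_log .tick _).seq
        (does_push_names true _))) _ _ (ih _ (by simp))) ?_ (by omega)
      simp only [Mem.mk.injEq, true_and, and_true]
      refine ⟨?_, ?_, ?_⟩
      · funext i; cases i <;> simp; omega
      · rw [List.append_cons, ← List.replicate_succ']
      · rw [List.append_cons, ← List.replicate_succ']
  refine Does.to ((key c _ rfl).seq (does_moveNum (by decide) _)) ?_ ?_
  · simp only [parseMem, Mem.mk.injEq, and_true]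
    funext i
    cases i <;> simp [regs]
  · simp [parseMem, regs]; omega

theorem does_newNode (o : NodeOp) (c x z : ℕ) (rev : List LatSymbol) (log : List NodeSymbol)
    (names : List Bool) :
    Does (newNode o) (parseMem w (regs c x 0 z 0 0 0) rev log names)
      (parseMem w (regs (c + 1) 0 0 0 0 0 0) rev ((Node.mk o x c z).word ++ log)
        (List.replicate c true ++ false :: names)) (6 * c + 2 * x + 2 * z + 13) := by
  have h₁ : Does (C := C) (repeatNum .z₁ (push .log .tick))
      (parseMem w (regs c x 0 z 0 0 0) rev (.op o :: log) names)
      (parseMem w (regs c x 0 0 0 0 0) rev (List.replicate z .tick ++ .op o :: log) names)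
      (2 * z + 2) :=
    Does.to (does_log_ticks .z₁ _) (by simp [parseMem, regs_z₁]; simp [regs]) le_rfl
  have h₂ : Does (C := C) (push (.num .cnt) ())
      (parseMem w (regs c x 0 0 0 0 0) rev (List.replicate c .tick ++ .sep₂ ::
        (List.replicate z .tick ++ .op o :: log)) (List.replicate c true ++ false :: names))
      (parseMem w (regs (c + 1) x 0 0 0 0 0) rev (List.replicate c .tick ++ .sep₂ ::
        (List.replicate z .tick ++ .op o :: log)) (List.replicate c true ++ false :: names)) 1 :=
    Does.to (does_inc .cnt _) (by simp [parseMem, regs_cnt]; rfl) le_rfl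
  have h₃ : Does (C := C) (repeatNum .x₁ (push .log .tick))
      (parseMem w (regs (c + 1) x 0 0 0 0 0) rev (.sep₁ :: (List.replicate c .tick ++ .sep₂ ::
        (List.replicate z .tick ++ .op o :: log))) (List.replicate c true ++ false :: names))
      (parseMem w (regs (c + 1) 0 0 0 0 0 0) rev ((Node.mk o x c z).word ++ log)
        (List.replicate c true ++ false :: names)) (2 * x + 2) :=
    Does.to (does_log_ticks .x₁ _) (by simp [parseMem, regs_x₁, Node.word]; simp [regs]) le_rfl
  exact ((does_push_log (.op o) _).seq (h₁.seq ((does_push_log .sep₂ _).seq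
    ((does_push_names false _).seq ((does_newName c x 0 rev _ _).seq
    (h₂.seq ((does_push_log .sep₁ _).seq h₃))))))).mono (by omega)

theorem does_popName (i : Num) (n : ℕ) (l : List Bool) (s : Mem C)
    (h : s.names = List.replicate n true ++ false :: l) :
    Does (popName i) s { s with num := Function.update s.num i (s.num i + n), names := l }
      (2 * n + 2) := by
  induction n generalizing s with
  | zero =>
    have e : s.stack .names = false :: l := h
    have := runs_loop_exit (Γ := Alphabet C) (k := .names) (c := fun o => o == some true)
      (f := fun o =>
        match o with
        | some true => push (.num i) ()
        | _ => skip) (S := s.stack) (by simp [e]) (runs_skip _ |> fun h => by rw [e]; exact h)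
    rw [Mem.update_names] at this
    refine Does.to this ?_ le_rfl
    simp
  | succ n ih =>
    have e : s.stack .names = true :: (List.replicate n true ++ false :: l) := h
    have := runs_loop_again (Γ := Alphabet C) (k := .names) (c := fun o => o == some true)
      (f := fun o =>
        match o with
        | some true => push (.num i) ()
        | _ => skip) (S := s.stack) (by simp [e])
        (by rw [e, Mem.update_names]; exact does_inc i _) (ih _ (by simp))
    refine Does.to this ?_ (by omega)
    simp [Nat.add_assoc, Nat.add_comm 1 n]

theorem loops_rev {f : LatSymbol → Prog (Alphabet C)} {a : LatSymbol} {s s' : Mem C}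
    {l : List LatSymbol} {n : ℕ} (h : s.rev = a :: l)
    (hf : Does (f a) { s with rev := l } s' n) : Loops (forEach .rev f) s s' (n + 1) := by
  refine iter_forEach (Γ := Alphabet C) (a := a) (l := l) h ?_
  rw [Mem.update_rev]
  exact hf

theorem loops_parse_ticks (num : Num → ℕ) (l : List LatSymbol) (log : List NodeSymbol)
    (names : List Bool) (n : ℕ) :
    Loops (forEach .rev parseStep) (parseMem w num (List.replicate n .tick ++ l) log names)
      (parseMem w num l (List.replicate n .tick ++ log) names) (2 * n) := by
  induction n generalizing log with
  | zero => exact Iter.refl _ _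
  | succ n ih =>
    have h := loops_rev (f := parseStep) (s := parseMem w num (List.replicate (n + 1) .tick ++ l)
      log names) (a := .tick) rfl (does_push_log .tick _)
    refine Loops.to (h.trans (ih (.tick :: log))) ?_ (by omega)
    rw [List.append_cons, ← List.replicate_succ']

/-- The left operand is parsed last, so its name is on top and is popped into `x₁` first. -/
theorem loops_parse_op {a : LatSymbol} {o : NodeOp} {m : ℕ}
    (ha : parseStep (C := C) a = popName .x₁ ;; popName .z₁ ;; newNode o) (c x z : ℕ)
    (hc : c ≤ m) (hx : x ≤ m) (hz : z ≤ m) (l : List LatSymbol) (log : List NodeSymbol)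
    (names : List Bool) :
    Loops (forEach .rev parseStep)
      (parseMem w (regs c 0 0 0 0 0 0) (a :: l) log
        (List.replicate x true ++ false :: (List.replicate z true ++ false :: names)))
      (parseMem w (regs (c + 1) 0 0 0 0 0 0) l ((Node.mk o x c z).word ++ log)
        (List.replicate c true ++ false :: names)) (18 * (m + 1)) := by
  have h₁ : Does (C := C) (popName .x₁) (parseMem w (regs c 0 0 0 0 0 0) l log
        (List.replicate x true ++ false :: (List.replicate z true ++ false :: names)))
      (parseMem w (regs c x 0 0 0 0 0) l log (List.replicate z true ++ false :: names)) _ :=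
    Does.to (does_popName .x₁ x _ _ rfl) (by simp [parseMem, regs_x₁]; simp [regs]) le_rfl
  have h₂ : Does (C := C) (popName .z₁) (parseMem w (regs c x 0 0 0 0 0) l log
        (List.replicate z true ++ false :: names))
      (parseMem w (regs c x 0 z 0 0 0) l log names) _ :=
    Does.to (does_popName .z₁ z _ _ rfl) (by simp [parseMem, regs_z₁]; simp [regs]) le_rfl
  have h₃ := h₁.seq (h₂.seq (does_newNode o c x z l log names))
  rw [← ha] at h₃
  exact (loops_rev rfl h₃).mono (by omega)

theorem loops_parse_leaf {a : LatSymbol} {o : NodeOp} (ha : parseStep (C := C) a = newNode o)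
    (c : ℕ) (l : List LatSymbol) (log : List NodeSymbol) (names : List Bool) :
    Loops (forEach .rev parseStep)
      (parseMem w (regs c 0 0 0 0 0 0) (a :: l) log names)
      (parseMem w (regs (c + 1) 0 0 0 0 0 0) l ((Node.mk o 0 c 0).word ++ log)
        (List.replicate c true ++ false :: names)) (6 * c + 14) := by
  have h := does_newNode (w := w) o c 0 0 l log names
  rw [← ha] at h
  exact (loops_rev rfl h).mono (by omega)

/-- Read from its end, prefix notation presents both operands before their operation, so a stack
with the root names of the finished subterms is enough. The right operand is read first and gets the
smaller names, in agreement with `BLatTerm.nodes`. -/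
theorem loops_parse (t : BLatTerm) {m : ℕ} : ∀ (c : ℕ), t.encode.length ≤ c → c + t.ops ≤ m →
    ∀ (l : List LatSymbol) (log : List NodeSymbol) (names : List Bool),
    Loops (forEach .rev parseStep)
      (parseMem w (regs c 0 0 0 0 0 0) (t.encode.reverse ++ l) log names)
      (parseMem w (regs (c + t.ops + 1) 0 0 0 0 0 0) l (nodesWord (t.nodes c) ++ log)
        (List.replicate (c + t.ops) true ++ false :: names))
      (t.encode.length * (18 * (m + 1))) := by
  induction t with
  | var n =>
    intro c hl hm l log names
    -- The leaf is first logged with index 0. The ticks read afterwards land in front of its word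
    -- and become its index.
    have h₁ := (loops_parse_leaf (w := w) (a := .var) rfl c (List.replicate n .tick ++ l) log
      names).trans (loops_parse_ticks _ _ _ _ n)
    have e : (BLatTerm.var n).encode.reverse ++ l = .var :: (List.replicate n .tick ++ l) := by
      simp [BLatTerm.encode]
    rw [e]
    refine Loops.to h₁ ?_ ?_
    · simp [BLatTerm.ops, BLatTerm.nodes, nodesWord, Node.word]
    · simp [BLatTerm.encode, BLatTerm.ops] at *
      nlinarith
  | zero | one =>
    intro c hl hm l log names
    refine Loops.to (loops_parse_leaf rfl c l log names) ?_ ?_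
    · simp [BLatTerm.ops, BLatTerm.nodes, nodesWord]
    · simp [BLatTerm.encode, BLatTerm.ops] at *
      nlinarith
  | join t s iht ihs =>
    intro c hl hm l log names
    simp only [BLatTerm.encode, List.length_cons, List.length_append, BLatTerm.ops] at hl hm
    have e : (BLatTerm.join t s).encode.reverse ++ l =
        s.encode.reverse ++ (t.encode.reverse ++ .join :: l) := by simp [BLatTerm.encode]
    rw [e]
    refine Loops.to ((ihs c (by omega) (by omega) _ _ _).trans
      ((iht (c + s.ops + 1) (by omega) (by omega) _ _ _).trans
      (loops_parse_op (m := m) rfl _ _ _ (by omega) (by omega) (by omega) _ _ _))) ?_ ?_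
    · have e₂ : c + (t.ops + s.ops + 2) = c + s.ops + 1 + t.ops + 1 := by omega
      simp [BLatTerm.ops, BLatTerm.nodes, nodesWord, e₂]
    · simp only [BLatTerm.encode, List.length_cons, List.length_append]
      nlinarith
  | meet t s iht ihs =>
    intro c hl hm l log names
    simp only [BLatTerm.encode, List.length_cons, List.length_append, BLatTerm.ops] at hl hm
    have e : (BLatTerm.meet t s).encode.reverse ++ l =
        s.encode.reverse ++ (t.encode.reverse ++ .meet :: l) := by simp [BLatTerm.encode]
    rw [e]
    refine Loops.to ((ihs c (by omega) (by omega) _ _ _).trans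
      ((iht (c + s.ops + 1) (by omega) (by omega) _ _ _).trans
      (loops_parse_op (m := m) rfl _ _ _ (by omega) (by omega) (by omega) _ _ _))) ?_ ?_
    · have e₂ : c + (t.ops + s.ops + 2) = c + s.ops + 1 + t.ops + 1 := by omega
      simp [BLatTerm.ops, BLatTerm.nodes, nodesWord, e₂]
    · simp only [BLatTerm.encode, List.length_cons, List.length_append]
      nlinarith

end LatticeRefutability

namespace LatticeRefutability

open Prog

variable {C : Type} {w : List C}

/-! ### The reduction -/

/-- Write the equations for the pair of terms whose reversed word is on the stack `rev` and has
length `cnt`. -/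
def writeSystem : Prog (Alphabet C) :=
  forEach .rev parseStep ;; popName .x₁ ;; popName .x₂ ;; rootTemplate.write ;;
  clear (.num .x₁) ;; clear (.num .x₂) ;; drain .log .bak id ;;
  forEach .bak (fun a => push .log a ;; push .log' a) ;;
  forEach .log rowStep ;; clear .log' ;; clear (.num .cnt)

/-- Two copies of the node list are needed, since rows and columns are scanned by nested loops. -/
theorem does_copy (l : List NodeSymbol) (s : Mem C) (h : s.bak = l) :
    Does (forEach .bak (fun a => push .log a ;; push .log' a)) s
      { s with bak := [], log := l.reverse ++ s.log, log' := l.reverse ++ s.log' }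
      (3 * l.length + 2) := by
  induction l generalizing s with
  | nil =>
    refine Does.to (runs_forEach_nil h) ?_ le_rfl
    cases s
    simp_all
  | cons a l ih =>
    have h₁ : Loops (C := C) (forEach .bak (fun a => push .log a ;; push .log' a)) s
        { s with bak := l, log := a :: s.log, log' := a :: s.log' } (2 + 1) := by
      refine iter_forEach (Γ := Alphabet C) (a := a) (l := l) h ?_
      rw [Mem.update_bak]
      have := runs_push (Γ := Alphabet C) .log' a
        ({ s with bak := l, log := a :: s.log } : Mem C).stack
      rw [Mem.update_log'] at this
      exact (does_push_log a { s with bak := l }).seq this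
    refine Does.to (h₁ _ _ (ih _ rfl)) ?_ (by simp; omega)
    simp

theorem bounded_pairNodes {e : BLatTerm × BLatTerm} {c : ℕ} (h : e.1.encode.length ≤ c)
    (h' : e.2.encode.length ≤ c) :
    ∀ R ∈ pairNodes e c, R.Bounded (c + e.2.ops + 1 + e.1.ops + 1) := by
  intro R hR
  rcases List.mem_append.1 hR with hR | hR
  · exact e.1.bounded_of_mem_nodes hR (by omega) (by omega)
  · exact e.2.bounded_of_mem_nodes hR h' (by omega)

/-- For an input of length c there are at most c nodes, and all counters are at most 2c. About c²
pairs of nodes, each at a cost quadratic in c, give degree 4. The stack `todo` is carried along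
untouched, because the verifier keeps its certificate there. -/
theorem does_writeSystem (e : BLatTerm × BLatTerm) :
    Does writeSystem
      (parseMem w (regs (BLatTerm.encodePair e).length 0 0 0 0 0 0)
        (BLatTerm.encodePair e).reverse [] [])
      { out := RingTerm.encodeList (pairSystem e (BLatTerm.encodePair e).length), todo := w }
      (500 * (2 * (BLatTerm.encodePair e).length + 1) ^ 4) := by
  have hn : (BLatTerm.encodePair e).length = e.1.encode.length + e.2.encode.length := by
    simp [BLatTerm.encodePair]
  have hr : (BLatTerm.encodePair e).reverse = e.2.encode.reverse ++ (e.1.encode.reverse ++ []) := by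
    simp [BLatTerm.encodePair]
  rw [hr]
  generalize (BLatTerm.encodePair e).length = c at hn
  have o₁ := e.1.ops_lt_length
  have o₂ := e.2.ops_lt_length
  have hB := bounded_pairNodes (e := e) (c := c) (by omega) (by omega)
  have hN : (pairNodes e c).length ≤ c := by
    simp only [pairNodes, List.length_append, BLatTerm.length_nodes]; omega
  have hlen := length_nodesWord_le hB
  have h₁ := ((loops_parse (w := w) e.2 (m := 2 * c) c (by omega) (by omega)
    (e.1.encode.reverse ++ []) [] []).trans
    (loops_parse e.1 (m := 2 * c) (c + e.2.ops + 1) (by omega) (by omega) [] _ _)) _ _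
    (runs_forEach_nil rfl)
  set m := c + e.2.ops + 1 + e.1.ops + 1 with hm
  have hmc : m ≤ 2 * c := by omega
  set r₁ := c + e.2.ops + 1 + e.1.ops with hr₁
  set r₂ := c + e.2.ops with hr₂
  have e₁ : nodesWord (e.1.nodes (c + e.2.ops + 1)) ++ (nodesWord (e.2.nodes c) ++ []) =
      nodesWord (pairNodes e c) := by simp [nodesWord, pairNodes]
  rw [e₁] at h₁
  set W := nodesWord (pairNodes e c) with hW
  have h₂ : Does (C := C) (popName .x₁) (parseMem w (regs m 0 0 0 0 0 0) [] W
        (List.replicate r₁ true ++ false :: (List.replicate r₂ true ++ false :: [])))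
      (parseMem w (regs m r₁ 0 0 0 0 0) [] W (List.replicate r₂ true ++ false :: [])) _ :=
    Does.to (does_popName .x₁ r₁ _ _ rfl) (by simp [parseMem, regs_x₁]; simp [regs]) le_rfl
  have h₃ : Does (C := C) (popName .x₂) (parseMem w (regs m r₁ 0 0 0 0 0) [] W
        (List.replicate r₂ true ++ false :: []))
      (pairMem w (regs m r₁ 0 0 r₂ 0 0) W [] [] []) _ :=
    Does.to (does_popName .x₂ r₂ _ _ rfl) (by simp [parseMem, pairMem, regs_x₂]; simp [regs])
      le_rfl
  have h₄ := does_write (C := C) rootTemplate (by simp [rootTemplate, Template.Proper])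
    (pairMem w (regs m r₁ 0 0 r₂ 0 0) W [] [] []) rfl rfl
    (regs_le le_rfl (by omega) (by omega) (by omega) (by omega) (by omega) (by omega) : ∀ i,
      regs m r₁ 0 0 r₂ 0 0 i ≤ m)
  set out := (rootTemplate.inst (regs m r₁ 0 0 r₂ 0 0)).encode with hout
  have h₅ : Does (C := C) (clear (.num .x₁)) (pairMem w (regs m r₁ 0 0 r₂ 0 0) W [] [] (out ++ []))
      (pairMem w (regs m 0 0 0 r₂ 0 0) W [] [] out) (2 * r₁ + 2) :=
    Does.to (does_clear_num .x₁ _) (by simp [pairMem, regs_x₁]) le_rfl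
  have h₆ : Does (C := C) (clear (.num .x₂)) (pairMem w (regs m 0 0 0 r₂ 0 0) W [] [] out)
      (pairMem w (regs m 0 0 0 0 0 0) W [] [] out) (2 * r₂ + 2) :=
    Does.to (does_clear_num .x₂ _) (by simp [pairMem, regs_x₂]) le_rfl
  have h₇ : Does (C := C) (drain .log .bak id) (pairMem w (regs m 0 0 0 0 0 0) W [] [] out)
      (pairMem w (regs m 0 0 0 0 0 0) [] [] W.reverse out) (2 * W.length + 2) := by
    have := runs_drain (Γ := Alphabet C) (k := .log) (k' := .bak) (by decide) id
      (pairMem w (regs m 0 0 0 0 0 0) W [] [] out).stack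
    rw [Mem.update_log, Mem.update_bak] at this
    exact Does.to this (by simp [pairMem, Mem.stack]) le_rfl
  have h₈ : Does (C := C) _ (pairMem w (regs m 0 0 0 0 0 0) [] [] W.reverse out)
      (pairMem w (regs m 0 0 0 0 0 0) W W [] out) _ :=
    Does.to (does_copy W.reverse _ rfl) (by simp [pairMem]) le_rfl
  have h₉ := loops_rows_nodes (C := C) (w := w) m out (pairNodes e c) hB (pairNodes e c) hB _ _
    (runs_forEach_nil rfl)
  have h₁₀ := runs_clear (Γ := Alphabet C) .log' (pairMem w (regs m 0 0 0 0 0 0) [] W []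
    (RingTerm.encodeList ((pairNodes e c).reverse.flatMap (rowNodeEqs m (pairNodes e c))) ++
      out)).stack
  rw [Mem.update_log'] at h₁₀
  have h₁₁ : Does (C := C) (clear (.num .cnt)) { pairMem w (regs m 0 0 0 0 0 0) [] W []
        (RingTerm.encodeList ((pairNodes e c).reverse.flatMap (rowNodeEqs m (pairNodes e c))) ++
          out) with log' := [] }
      { out := RingTerm.encodeList (pairSystem e c), todo := w } (2 * m + 2) := by
    refine Does.to (does_clear_num .cnt _) ?_ le_rfl
    simp only [pairMem, regs_cnt, pairSystem, ← hm, ← hr₁, ← hr₂, hout, Mem.mk.injEq,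
      and_true, RingTerm.encodeList, List.flatMap_append, List.flatMap_cons, List.flatMap_nil,
      List.append_nil]
    funext i
    cases i <;> rfl
  refine (h₁.seq (h₂.seq (h₃.seq (h₄.seq (h₅.seq (h₆.seq (h₇.seq (h₈.seq
    (h₉.seq (h₁₀.seq h₁₁)))))))))).mono ?_
  have hs : rootTemplate.size = 5 := rfl
  have hWl : ((pairMem w (regs m 0 0 0 0 0 0) [] W []
    (RingTerm.encodeList ((pairNodes e c).reverse.flatMap (rowNodeEqs m (pairNodes e c))) ++
      out)).stack .log').length = W.length := rfl
  rw [hs, hWl, List.length_reverse]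
  generalize W.length = k at hlen
  generalize (pairNodes e c).length = N at hN hlen
  generalize hu : 2 * c + 1 = u
  have b₁ : m + 1 ≤ u := by omega
  have b₂ : (m + 1) ^ 2 ≤ u ^ 2 := Nat.pow_le_pow_left b₁ 2
  have b₃ : N * ((N + 1) * (300 * (m + 1) ^ 2)) ≤ u * (u * (300 * u ^ 2)) := by
    gcongr <;> omega
  have b₄ : N * (3 * m + 3) ≤ u * (3 * u) := by gcongr <;> omega
  have b₅ : e.2.encode.length * (18 * u) + e.1.encode.length * (18 * u) ≤ u * (18 * u) := by
    rw [← Nat.add_mul]; gcongr; omega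
  have b₆ : u * 1 ≤ u * u ^ 3 := Nat.mul_le_mul_left u (Nat.one_le_pow _ _ (by omega))
  have b₇ : u ^ 2 * 1 ≤ u ^ 2 * u ^ 2 := Nat.mul_le_mul_left _ (Nat.one_le_pow _ _ (by omega))
  have b₈ : 1 ≤ u := by omega
  ring_nf at *
  omega

/-- Translate a pair of lattice terms into a system of equations. -/
def reduce : Prog (Alphabet C) :=
  forEach .src (fun a => push .rev a ;; push (.num .cnt) ()) ;; writeSystem

theorem does_push_rev (a : LatSymbol) (s : Mem C) :
    Does (push .rev a) s { s with rev := a :: s.rev } 1 := by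
  have := runs_push (Γ := Alphabet C) .rev a s.stack
  rwa [Mem.update_rev] at this

theorem does_load (l : List LatSymbol) : ∀ (n : ℕ) (r : List LatSymbol),
    Does (C := C) (forEach .src (fun a => push .rev a ;; push (.num .cnt) ()))
      { num := regs n 0 0 0 0 0 0, src := l, rev := r }
      { num := regs (n + l.length) 0 0 0 0 0 0, rev := l.reverse ++ r } (3 * l.length + 2) := by
  induction l with
  | nil => exact fun n r => runs_forEach_nil rfl
  | cons a l ih =>
    intro n r
    have h₁ : Loops (C := C) (forEach .src (fun a => push .rev a ;; push (.num .cnt) ()))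
        { num := regs n 0 0 0 0 0 0, src := a :: l, rev := r }
        { num := regs (n + 1) 0 0 0 0 0 0, src := l, rev := a :: r } (2 + 1) := by
      refine iter_forEach (Γ := Alphabet C) (a := a) (l := l) rfl ?_
      rw [Mem.update_src]
      exact (does_push_rev a _).seq (Does.to (does_inc .cnt _) (by simp [regs_cnt]; rfl) le_rfl)
    refine Does.to (h₁ _ _ (ih _ _)) ?_ (by simp; omega)
    simp [Nat.add_comm 1, Nat.add_assoc]

theorem does_reduce (e : BLatTerm × BLatTerm) :
    Does (C := C) reduce { src := BLatTerm.encodePair e }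
      { out := RingTerm.encodeList (pairSystem e (BLatTerm.encodePair e).length) }
      (3 * (BLatTerm.encodePair e).length + 2 +
        500 * (2 * (BLatTerm.encodePair e).length + 1) ^ 4) := by
  have h₁ := does_load (C := C) (BLatTerm.encodePair e) 0 []
  rw [Nat.zero_add, List.append_nil] at h₁
  have e₁ : regs 0 0 0 0 0 0 0 = fun _ => 0 := by funext i; cases i <;> rfl
  rw [e₁] at h₁
  exact h₁.seq (does_writeSystem e)

/-- The system of equations for a pair of bounded lattice terms. -/
def system (e : BLatTerm × BLatTerm) : List RingTerm :=
  pairSystem e (BLatTerm.encodePair e).length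

open Polynomial in
-- The machine sees only the word. Terms with and without constants are written in the same way, so
-- one program serves both signatures.
theorem polyTime_system {α : Type} (ea : α → List LatSymbol) (g : α → BLatTerm × BLatTerm)
    (h : ∀ x, ea x = BLatTerm.encodePair (g x)) :
    Nonempty (Turing.TM2ComputableInPolyTime ea RingTerm.encodeList fun x => system (g x)) := by
  refine polyTime_of_runs (Γ := Alphabet Unit) reduce .src .out
    (3 * X + 2 + 500 * (2 * X + 1) ^ 4) fun x => ?_
  have := does_reduce (C := Unit) (g x)
  have e₀ : (fun _ => []) = ({} : Mem Unit).stack := by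
    funext k; cases k <;> rfl
  rw [e₀, Mem.update_src, Mem.update_out, h]
  simpa [system] using this

end LatticeRefutability

namespace LatticeRefutability

open Prog

/-! ### Output length from running time -/

namespace Prog

open Turing

variable {K : Type} {Γ : K → Type} [DecidableEq K]

/-- The code at each program point pushes at most one symbol before it jumps. -/
theorem length_stepAux_code {Λ : Type} (P : Prog Γ) (ι : P.Point → Λ) (e : Λ) (l : P.Point)
    (v : ∀ k, Option (Γ k)) (S : ∀ k, List (Γ k)) (k : K) :
    ((TM2.stepAux (P.code ι e l) v S).stk k).length ≤ (S k).length + 1 := by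
  induction P generalizing Λ with
  | skip => simp [code]
  | push j a =>
    by_cases h : k = j
    · subst h; simp [code]
    · simp [code, h]
  | seq P Q ihP ihQ =>
    cases l with
    | inl l => exact ihP _ _ l
    | inr l => exact ihQ _ _ l
  | loop j c f ih =>
    cases l with
    | none =>
      by_cases h : k = j
      · subst h; simp [code]; omega
      · simp [code, h]
    | some l => exact ih _ _ _ l.2

/-- A program that finishes after `n` steps adds at most `n` symbols to each stack. -/
theorem Runs.length_le {P : Prog Γ} {S S' : ∀ k, List (Γ k)} {n : ℕ} (h : Runs P S S' n) (k : K) :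
    (S' k).length ≤ (S k).length + n := by
  let M : Option P.Point → TM2.Stmt Γ (Option P.Point) (∀ k, Option (Γ k)) := fun l =>
    match l with
    | none => .halt
    | some l => P.code some none l
  have hM : ∀ (l : Option P.Point) v (S : ∀ k, List (Γ k)),
      ((TM2.stepAux (M l) v S).stk k).length ≤ (S k).length + 1 := by
    intro l v S
    cases l with
    | none => simp [M]
    | some l => exact length_stepAux_code _ _ _ _ _ _ _
  have key : ∀ (m : ℕ) (a b : TM2.Cfg Γ (Option P.Point) (∀ k, Option (Γ k))),
      StepsIn M m a b → (b.stk k).length ≤ (a.stk k).length + m := by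
    intro m
    induction m with
    | zero =>
      intro a b hab
      cases hab
      exact le_rfl
    | succ m ih =>
      intro a b hab
      unfold StepsIn at hab
      rw [Function.iterate_succ_apply'] at hab
      obtain ⟨c, hc, hcb⟩ := Option.bind_eq_some_iff.1 hab
      have h₁ := ih a c hc
      obtain ⟨l, v, T⟩ := c
      cases l with
      | none => simp [TM2.step] at hcb
      | some l =>
        simp only [TM2.step, Option.some.injEq] at hcb
        subst hcb
        have := hM l v T
        simp only at h₁
        omega
  obtain ⟨v', m, hm, hs⟩ := h (Option P.Point) M some none (fun l => rfl) (fun _ => none)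
  have := key m _ _ hs
  simp only at this
  omega

/-- Pop a symbol from stack `k` and run the program that `f` assigns to it. -/
def pop (k : K) (f : Option (Γ k) → Prog Γ) : Prog Γ := loop k (fun _ => false) f

theorem runs_pop {k : K} {f : Option (Γ k) → Prog Γ} {S S' : ∀ k, List (Γ k)} {n : ℕ}
    (h : Runs (f (S k).head?) (Function.update S k (S k).tail) S' n) :
    Runs (pop k f) S S' (n + 1) :=
  runs_loop_exit rfl h

end Prog

/-- No count of symbols is needed: the program that writes the system starts with empty output and
stops within this time. -/
theorem length_encode_system (e : BLatTerm × BLatTerm) :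
    (RingTerm.encodeList (system e)).length ≤
      500 * (2 * (BLatTerm.encodePair e).length + 1) ^ 4 := by
  simpa [Mem.stack, parseMem, system] using
    (does_writeSystem (C := Unit) (w := []) e).length_le .out

/-! ### Evaluating ring terms -/

section eval

variable {C : Type} [Ring C]

/-- Put a copy of the top of `todo` on the stack of values. -/
def fetch : Prog (Alphabet C) :=
  pop .todo fun o =>
    match o with
    | none => push .vals 0
    | some a => push .todo a ;; push .vals a

/-- Replace the two topmost values by the result of an operation. -/
def operate (g : C → C → C) : Prog (Alphabet C) :=
  pop .vals fun o => pop .vals fun o' => push .vals (g (o.getD 0) (o'.getD 0))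

/-- Process one symbol of a reversed word of a ring term. -/
def evalStep : RingSymbol → Prog (Alphabet C)
  | .tick => pop .vals (fun _ => skip) ;;
      pop .todo (fun o =>
        match o with
        | none => skip
        | some a => push .done a) ;; fetch
  | .var => drain .done .todo id ;; fetch
  | .zero => push .vals 0
  | .one => push .vals 1
  | .add => operate (fun a b => a + b)
  | .sub => operate (fun a b => a - b)
  | .mul => operate (fun a b => a * b)

/-- The memory during evaluation. -/
def evalMem (outr : List RingSymbol) (todo done vals : List C) : Mem C :=
  { outr := outr, todo := todo, done := done, vals := vals }

theorem does_fetch (l : List RingSymbol) (todo done vals : List C) :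
    Does fetch (evalMem l todo done vals) (evalMem l todo done (todo.headD 0 :: vals)) 3 := by
  have h₁ : ∀ a (s : Mem C), Does (push .vals a) s { s with vals := a :: s.vals } 1 := by
    intro a s
    have := runs_push (Γ := Alphabet C) .vals a s.stack
    rwa [Mem.update_vals] at this
  cases todo with
  | nil =>
    refine Runs.mono (runs_pop ?_) (m := 1 + 1) (by omega)
    rw [Mem.update_todo]
    exact h₁ 0 _
  | cons a todo =>
    refine Runs.mono (runs_pop ?_) (m := 2 + 1) (by omega)
    rw [Mem.update_todo]
    have := runs_push (Γ := Alphabet C) .todo a (evalMem l todo done vals).stack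
    rw [Mem.update_todo] at this
    exact this.seq (h₁ a _)

theorem does_operate (g : C → C → C) (l : List RingSymbol) (todo done vals : List C) (a b : C) :
    Does (operate g) (evalMem l todo done (a :: b :: vals))
      (evalMem l todo done (g a b :: vals)) 3 := by
  refine Runs.mono (runs_pop (runs_pop ?_)) (m := 1 + 1 + 1) (by omega)
  rw [Mem.update_vals]
  rw [Mem.update_vals]
  have := runs_push (Γ := Alphabet C) .vals (g a b) (evalMem l todo done vals).stack
  rw [Mem.update_vals] at this
  exact this

theorem loops_eval_symbol {a : RingSymbol} {l : List RingSymbol}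
    {todo done vals todo' done' vals' : List C} {n : ℕ}
    (h : Does (evalStep a) (evalMem l todo done vals) (evalMem l todo' done' vals') n) :
    Loops (forEach .outr evalStep) (evalMem (a :: l) todo done vals)
      (evalMem l todo' done' vals') (n + 1) := by
  refine iter_forEach (Γ := Alphabet C) (a := a) (l := l) rfl ?_
  rw [Mem.update_outr]
  exact h

/-- The stacks `done` and `todo` hold `D` with a cursor between them. The symbol `var` rewinds and
fetches entry 0; each tick discards the fetched value, advances the cursor and fetches again. Past
the end the value is 0, as with `getD`. -/
theorem loops_eval_var (D : List C) (n : ℕ) (l : List RingSymbol) (todo done vals : List C)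
    (hD : done.reverse ++ todo = D) :
    Loops (forEach .outr evalStep)
      (evalMem (.var :: (List.replicate n .tick ++ l)) todo done vals)
      (evalMem l (D.drop n) (D.take n).reverse (D.getD n 0 :: vals))
      ((n + 1) * (2 * D.length + 12)) := by
  induction n generalizing l with
  | zero =>
    have h₁ := runs_drain (Γ := Alphabet C) (k := .done) (k' := .todo) (by decide) id
      (evalMem l todo done vals).stack
    rw [Mem.update_done, Mem.update_todo] at h₁
    have h₂ : Does (C := C) (drain .done .todo id) (evalMem l todo done vals)
      (evalMem l D [] vals) (2 * D.length + 2) :=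
      Does.to h₁ (by simp [evalMem, Mem.stack, hD]) (by simp [← hD, Mem.stack, evalMem])
    refine Loops.to (loops_eval_symbol (a := .var) (h₂.seq (does_fetch _ _ _ _))) ?_ (by omega)
    cases D <;> simp
  | succ n ih =>
    rw [List.replicate_succ', List.append_assoc]
    have h₁ : Does (C := C) (evalStep .tick)
        (evalMem l (D.drop n) (D.take n).reverse (D.getD n 0 :: vals))
        (evalMem l (D.drop (n + 1)) (D.take (n + 1)).reverse (D.getD (n + 1) 0 :: vals))
        (2 + (2 + 3)) := by
      refine Runs.seq (S' := (evalMem l (D.drop n) (D.take n).reverse vals).stack) (runs_pop ?_)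
        (Runs.seq (S' := (evalMem l (D.drop (n + 1)) (D.take (n + 1)).reverse vals).stack)
          (runs_pop ?_) ?_)
      · rw [Mem.update_vals]
        exact runs_skip _
      · rw [Mem.update_todo]
        by_cases hn : n < D.length
        · have e : D.drop n = D[n] :: D.drop (n + 1) := List.drop_eq_getElem_cons hn
          have := runs_push (Γ := Alphabet C) .done D[n]
            (evalMem l (D.drop (n + 1)) (D.take n).reverse vals).stack
          rw [Mem.update_done] at this
          simp only [Mem.stack, evalMem, e, List.head?_cons, List.tail_cons] at this ⊢
          rw [List.take_succ_eq_append_getElem hn]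
          rw [List.reverse_concat']
          exact this
        · have e : D.drop n = [] := List.drop_eq_nil_of_le (by omega)
          have e₁ : D.drop (n + 1) = [] := List.drop_eq_nil_of_le (by omega)
          have e₂ : D.take n = D := List.take_of_length_le (by omega)
          have e₃ : D.take (n + 1) = D := List.take_of_length_le (by omega)
          simp only [Mem.stack, evalMem, e, e₁, e₂, e₃, List.head?_nil, List.tail_nil]
          exact runs_skip _
      · have := does_fetch l (D.drop (n + 1)) (D.take (n + 1)).reverse vals
        have e : (D.drop (n + 1)).headD 0 = D.getD (n + 1) 0 := by
          simp [List.headD_eq_head?_getD, List.getD_eq_getElem?_getD]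
        rwa [e] at this
    refine Loops.to ((ih (.tick :: l)).trans (loops_eval_symbol (a := .tick) h₁)) rfl ?_
    nlinarith

/-- A word on the stack `outr` adds `v` to the stack of values. -/
def Evaluates (D : List C) (x : List RingSymbol) (v : C) : Prop :=
  ∀ (l : List RingSymbol) (todo done vals : List C), done.reverse ++ todo = D →
    ∃ todo' done' : List C, done'.reverse ++ todo' = D ∧
      Loops (forEach .outr evalStep) (evalMem (x.reverse ++ l) todo done vals)
        (evalMem l todo' done' (v :: vals)) (x.length * (2 * D.length + 12))

/-- The second operand is evaluated first, so that the first one ends up on top. The position of the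
cursor in between is irrelevant, since `Evaluates` allows any. -/
theorem loops_eval_binary {a : RingSymbol} {g : C → C → C} (ha : evalStep a = operate g)
    {D : List C} {x y : List RingSymbol} {u v : C} (hx : Evaluates D x u)
    (hy : Evaluates D y v) : Evaluates D (a :: (x ++ y)) (g u v) := by
  intro l todo done vals hD
  obtain ⟨todo₁, done₁, hD₁, h₁⟩ := hy (x.reverse ++ a :: l) todo done vals hD
  obtain ⟨todo₂, done₂, hD₂, h₂⟩ := hx (a :: l) todo₁ done₁ _ hD₁
  refine ⟨todo₂, done₂, hD₂, ?_⟩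
  have h₃ := does_operate g l todo₂ done₂ vals u v
  rw [← ha] at h₃
  have h₄ := (h₁.trans h₂).trans (loops_eval_symbol h₃)
  simp only [List.reverse_cons, List.reverse_append, List.append_assoc, List.cons_append,
    List.nil_append, List.length_cons, List.length_append]
  refine h₄.mono ?_
  nlinarith

theorem evaluates_encode (D : List C) (t : RingTerm) :
    Evaluates D t.encode (t.eval fun n => D.getD n 0) := by
  induction t with
  | var n =>
    intro l todo done vals hD
    refine ⟨_, _, ?_, Loops.to (?_ : Loops (C := C) _ _ (evalMem l (D.drop n) (D.take n).reverse _)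
      ((n + 1) * (2 * D.length + 12))) rfl ?_⟩
    · simp
    · have := loops_eval_var D n l todo done vals hD
      simpa [RingTerm.encode, RingTerm.eval] using this
    · simp [RingTerm.encode]
  | zero =>
    intro l todo done vals hD
    refine ⟨todo, done, hD, (loops_eval_symbol (a := .zero) (n := 1) ?_).mono ?_⟩
    · have := runs_push (Γ := Alphabet C) .vals 0 (evalMem l todo done vals).stack
      rwa [Mem.update_vals] at this
    · simp [RingTerm.encode]
  | one =>
    intro l todo done vals hD
    refine ⟨todo, done, hD, (loops_eval_symbol (a := .one) (n := 1) ?_).mono ?_⟩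
    · have := runs_push (Γ := Alphabet C) .vals 1 (evalMem l todo done vals).stack
      rwa [Mem.update_vals] at this
    · simp [RingTerm.encode]
  | add t s iht ihs => exact loops_eval_binary rfl iht ihs
  | sub t s iht ihs => exact loops_eval_binary rfl iht ihs
  | mul t s iht ihs => exact loops_eval_binary rfl iht ihs

end eval

end LatticeRefutability

namespace LatticeRefutability

open Prog

/-! ### Verifying a solution -/

section verify

variable {C : Type} [Ring C]

/-- Process one bit of a certificate: `false` appends a zero to the list of values, and `true`
increases the last value by one. -/
def decodeStep : List C → Bool → List C
  | D, false => 0 :: D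
  | [], true => []
  | a :: D, true => (a + 1) :: D

/-- The list of values that a certificate stands for. -/
def decode (w : List Bool) : List C := w.foldl decodeStep []

theorem length_foldl_decodeStep_le (w : List Bool) (D : List C) :
    (w.foldl decodeStep D).length ≤ D.length + w.length := by
  induction w generalizing D with
  | nil => simp
  | cons b w ih =>
    have h : (decodeStep D b).length ≤ D.length + 1 := by
      rcases b with _ | _ <;> rcases D with _ | ⟨a, D⟩ <;> simp [decodeStep]
    have := ih (decodeStep D b)
    simp only [List.foldl_cons, List.length_cons]
    omega

theorem length_decode_le (w : List Bool) : (decode w : List C).length ≤ w.length := by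
  simpa [decode] using length_foldl_decodeStep_le (C := C) w []

/-- Process one bit of a certificate. -/
def certStep : Bool → Prog (Alphabet C)
  | false => push .todo 0
  | true => pop .todo fun o =>
      match o with
      | none => skip
      | some a => push .todo (a + 1)

/-- Separate an input into the word of a pair of terms and a certificate. -/
def splitInput : Prog (Alphabet C) :=
  forEach .inp fun a =>
    match a with
    | .inl a => push .rev a ;; push (.num .cnt) ()
    | .inr b => certStep b

theorem does_certStep (b : Bool) (s : Mem C) :
    Does (certStep b) s { s with todo := decodeStep s.todo b } 2 := by
  cases b with
  | false =>
    have := runs_push (Γ := Alphabet C) .todo 0 s.stack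
    rw [Mem.update_todo] at this
    exact this.mono (by omega)
  | true =>
    refine runs_pop (n := 1) ?_
    rw [Mem.update_todo]
    obtain h | ⟨a, D, h⟩ : s.todo = [] ∨ ∃ a D, s.todo = a :: D := by cases s.todo <;> simp
    · simp only [Mem.stack, h, List.head?_nil, List.tail_nil, decodeStep]
      exact runs_skip _
    · have := runs_push (Γ := Alphabet C) .todo (a + 1) ({ s with todo := D } : Mem C).stack
      rw [Mem.update_todo] at this
      simp only [Mem.stack, h, List.head?_cons, List.tail_cons, decodeStep] at this ⊢
      exact this

theorem does_splitInput_certificate (w : List Bool) : ∀ (num : Num → ℕ) (r : List LatSymbol)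
    (D : List C), Does splitInput { num := num, inp := w.map Sum.inr, rev := r, todo := D }
      (parseMem (w.foldl decodeStep D) num r [] []) (3 * w.length + 2) := by
  induction w with
  | nil => exact fun num r D => runs_forEach_nil rfl
  | cons b w ih =>
    intro num r D
    have h₁ : Loops (C := C) splitInput
        { num := num, inp := (b :: w).map Sum.inr, rev := r, todo := D }
        { num := num, inp := w.map Sum.inr, rev := r, todo := decodeStep D b } (2 + 1) := by
      refine iter_forEach (Γ := Alphabet C) (k := .inp) (a := (Sum.inr b : LatSymbol ⊕ Bool))
         (l := w.map Sum.inr) rfl ?_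
      rw [Mem.update_inp]
      exact does_certStep b _
    exact (h₁ _ _ (ih num r _)).mono (by simp; omega)

theorem does_splitInput (l : List LatSymbol) (w : List Bool) : ∀ (n : ℕ) (r : List LatSymbol),
    Does (C := C) splitInput
      { num := regs n 0 0 0 0 0 0, inp := l.map Sum.inl ++ w.map Sum.inr, rev := r }
      (parseMem (decode w) (regs (n + l.length) 0 0 0 0 0 0) (l.reverse ++ r) [] [])
      (3 * l.length + (3 * w.length + 2)) := by
  induction l with
  | nil => exact fun n r => (does_splitInput_certificate w _ r []).mono (by simp)
  | cons a l ih =>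
    intro n r
    have h₁ : Loops (C := C) splitInput
        { num := regs n 0 0 0 0 0 0, inp := (a :: l).map Sum.inl ++ w.map Sum.inr, rev := r }
        { num := regs (n + 1) 0 0 0 0 0 0, inp := l.map Sum.inl ++ w.map Sum.inr, rev := a :: r }
        (2 + 1) := by
      refine iter_forEach (Γ := Alphabet C) (k := .inp) (a := (Sum.inl a : LatSymbol ⊕ Bool))
        (l := l.map Sum.inl ++ w.map Sum.inr)
        rfl ?_
      rw [Mem.update_inp]
      exact (does_push_rev a _).seq (Does.to (does_inc .cnt _) (by simp [regs_cnt]; rfl) le_rfl)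
    refine Does.to (h₁ _ _ (ih _ _)) ?_ (by simp; omega)
    simp [Nat.add_comm 1, Nat.add_assoc]

theorem loops_eval_list (D : List C) (ts : List RingTerm) :
    ∀ (l : List RingSymbol) (todo done vals : List C), done.reverse ++ todo = D →
    ∃ todo' done' : List C, done'.reverse ++ todo' = D ∧
      Loops (forEach .outr evalStep)
        (evalMem ((RingTerm.encodeList ts).reverse ++ l) todo done vals)
        (evalMem l todo' done' (ts.map (RingTerm.eval fun n => D.getD n 0) ++ vals))
        ((RingTerm.encodeList ts).length * (2 * D.length + 12)) := by
  induction ts with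
  | nil => exact fun l todo done vals hD => ⟨todo, done, hD, (Iter.refl _ _).mono (by simp)⟩
  | cons t ts ih =>
    intro l todo done vals hD
    obtain ⟨todo₁, done₁, hD₁, h₁⟩ := ih (t.encode.reverse ++ l) todo done vals hD
    obtain ⟨todo₂, done₂, hD₂, h₂⟩ := evaluates_encode D t l todo₁ done₁ _ hD₁
    refine ⟨todo₂, done₂, hD₂, ?_⟩
    have e : (RingTerm.encodeList (t :: ts)).reverse ++ l =
        (RingTerm.encodeList ts).reverse ++ (t.encode.reverse ++ l) := by
      simp [RingTerm.encodeList]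
    rw [e]
    refine (h₁.trans h₂).mono ?_
    simp only [RingTerm.encodeList, List.flatMap_cons, List.length_append]
    nlinarith

theorem length_le_length_encodeList (ts : List RingTerm) :
    ts.length ≤ (RingTerm.encodeList ts).length := by
  induction ts with
  | nil => simp
  | cons t ts ih =>
    have := List.length_pos_of_ne_nil t.encode_ne_nil
    simp only [RingTerm.encodeList, List.flatMap_cons, List.length_append, List.length_cons] at ih ⊢
    omega

variable [DecidableEq C]

/-- Decide whether all values are zero. -/
def verdict : Prog (Alphabet C) :=
  forEach .vals (fun a => if a = 0 then skip else push (.num .bad) ()) ;;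
  pop (.num .bad) (fun o => push .ans o.isNone) ;;
  clear (.num .bad) ;; clear .todo ;; clear .done

theorem does_countNonzero (todo done vals : List C) : ∀ num : Num → ℕ,
    Does (forEach .vals (fun a => if a = 0 then skip else push (.num .bad) ()))
      { evalMem [] todo done vals with num := num }
      { evalMem [] todo done [] with
        num := Function.update num .bad (num .bad + vals.countP (fun a => !decide (a = 0))) }
      (2 * vals.length + 2) := by
  induction vals with
  | nil =>
    intro num
    refine Does.to (runs_forEach_nil rfl) ?_ le_rfl
    simp
  | cons a vals ih =>
    intro num
    by_cases ha : a = 0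
    · have h₁ : Loops (C := C)
          (forEach .vals (fun a => if a = 0 then skip else push (.num .bad) ()))
          { evalMem [] todo done (a :: vals) with num := num }
          { evalMem [] todo done vals with num := num } (1 + 1) := by
        refine iter_forEach (Γ := Alphabet C) (a := a) (l := vals) rfl ?_
        rw [Mem.update_vals, if_pos ha]
        exact runs_skip _
      refine Does.to (h₁ _ _ (ih num)) ?_ (by simp; omega)
      simp [ha]
    · have h₁ : Loops (C := C)
          (forEach .vals (fun a => if a = 0 then skip else push (.num .bad) ()))
          { evalMem [] todo done (a :: vals) with num := num }
          { evalMem [] todo done vals with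
            num := Function.update num .bad (num .bad + 1) } (1 + 1) := by
        refine iter_forEach (Γ := Alphabet C) (a := a) (l := vals) rfl ?_
        rw [Mem.update_vals, if_neg ha]
        exact does_inc .bad _
      refine Does.to (h₁ _ _ (ih _)) ?_ (by simp; omega)
      simp [ha, Nat.add_comm 1, Nat.add_assoc]

theorem does_verdict (todo done vals : List C) :
    Does verdict (evalMem [] todo done vals) { ans := [decide (∀ v ∈ vals, v = 0)] }
      (4 * vals.length + 2 * todo.length + 2 * done.length + 10) := by
  have h₁ := does_countNonzero todo done vals (fun _ => 0)
  set n := vals.countP (fun a => !decide (a = 0)) with hn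
  have hnl : n ≤ vals.length := List.countP_le_length
  have e : decide (∀ v ∈ vals, v = 0) = decide (n = 0) := by
    rw [hn, decide_eq_decide, List.countP_eq_zero]
    simp
  rw [e]
  rw [Nat.zero_add] at h₁
  -- Testing `bad` for emptiness removes a unit; truncated subtraction covers the case where there
  -- is none.
  have h₂ : Does (C := C) (pop (.num .bad) (fun o => push .ans o.isNone))
      { evalMem [] todo done [] with num := Function.update (fun _ => 0) .bad n }
      { evalMem [] todo done [] with
        num := Function.update (fun _ => 0) .bad (n - 1), ans := [decide (n = 0)] } (1 + 1) := by
    refine runs_pop ?_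
    have hp := runs_push (Γ := Alphabet C) .ans (decide (n = 0))
      ({ evalMem [] todo done [] with
        num := Function.update (fun _ => 0) .bad (n - 1) } : Mem C).stack
    rw [Mem.update_ans] at hp
    have e₁ : Mem.stack (C := C) { evalMem [] todo done [] with
        num := Function.update (fun _ => 0) .bad n } (.num .bad) = List.replicate n () := by
      simp [Mem.stack]
    have e₂ : (List.replicate n ()).head?.isNone = decide (n = 0) := by
      cases n <;> simp [List.replicate_succ]
    rw [e₁, List.tail_replicate, Mem.update_num, e₂]
    simp only [Function.update_idem]
    exact hp
  have h₃ := does_clear_num (C := C) .bad { evalMem [] todo done [] with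
        num := Function.update (fun _ => 0) .bad (n - 1), ans := [decide (n = 0)] }
  have h₄ := runs_clear (Γ := Alphabet C) .todo
    ({ evalMem [] todo done [] with ans := [decide (n = 0)] } : Mem C).stack
  rw [Mem.update_todo] at h₄
  have h₅ := runs_clear (Γ := Alphabet C) .done
    ({ evalMem [] [] done [] with ans := [decide (n = 0)] } : Mem C).stack
  rw [Mem.update_done] at h₅
  have h₃' : Does (C := C) (clear (.num .bad)) _
    { evalMem [] todo done [] with ans := [decide (n = 0)] } (2 * n + 2) :=
    Does.to h₃ (by simp [evalMem]) (by simp)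
  refine (h₁.seq (h₂.seq (h₃'.seq (h₄.seq h₅)))).mono ?_
  simp only [Mem.stack, evalMem]
  omega

/-- Decide whether a certificate stands for a solution of the equations for a pair of terms. -/
def verify : Prog (Alphabet C) :=
  splitInput ;; writeSystem ;; drain .out .outr id ;; forEach .outr evalStep ;; verdict

/-- The main cost is the evaluation: each of at most `500 * (2 * L + 1) ^ 4` symbols takes at most
`2 * L + 12` steps, as the certificate stands for at most L values. Rewinding `done` is what makes
this depend on L. -/
theorem does_verify (e : BLatTerm × BLatTerm) (w : List Bool) {L : ℕ}
    (hL : (BLatTerm.encodePair e).length + w.length = L) :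
    Does (C := C) verify { inp := (BLatTerm.encodePair e).map Sum.inl ++ w.map Sum.inr }
      { ans := [decide (∀ v ∈ (system e).map (RingTerm.eval fun n => (decode w : List C).getD n 0),
        v = 0)] }
      (500 * (2 * L + 1) ^ 4 * (2 * L + 30) + 7 * L + 30) := by
  have h₁ := does_splitInput (C := C) (BLatTerm.encodePair e) w 0 []
  rw [Nat.zero_add, List.append_nil] at h₁
  have e₁ : regs 0 0 0 0 0 0 0 = fun _ => 0 := by funext i; cases i <;> rfl
  rw [e₁] at h₁
  have h₂ := does_writeSystem (w := (decode w : List C)) e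
  have h₃ := runs_drain (Γ := Alphabet C) (k := .out) (k' := .outr) (by decide) id
    ({ out := RingTerm.encodeList (pairSystem e (BLatTerm.encodePair e).length),
       todo := decode w } : Mem C).stack
  rw [Mem.update_out, Mem.update_outr] at h₃
  obtain ⟨todo, done, hD, h₄⟩ := loops_eval_list (decode w : List C) (system e) [] (decode w) [] []
    (by simp)
  have h₃' : Does (C := C) (drain .out .outr id) _
      (evalMem (RingTerm.encodeList (system e)).reverse (decode w) [] [])
      (2 * (RingTerm.encodeList (system e)).length + 2) :=
    Does.to h₃ (by simp [evalMem, system, Mem.stack]) le_rfl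
  have h₄' := h₄ _ _ (runs_forEach_nil rfl)
  simp only [List.append_nil] at h₄'
  refine (h₁.seq (h₂.seq (h₃'.seq (h₄'.seq (does_verdict todo done _))))).mono ?_
  have b₁ := length_encode_system e
  have b₂ := length_le_length_encodeList (system e)
  have b₃ := length_decode_le (C := C) w
  have b₄ : (decode w : List C).length = done.length + todo.length := by
    rw [← hD]; simp
  have b₅ : 500 * (2 * (BLatTerm.encodePair e).length + 1) ^ 4 ≤ 500 * (2 * L + 1) ^ 4 := by
    gcongr; omega
  rw [List.length_map]
  generalize 500 * (2 * (BLatTerm.encodePair e).length + 1) ^ 4 = T at *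
  generalize 500 * (2 * L + 1) ^ 4 = U at *
  generalize (RingTerm.encodeList (system e)).length = k at *
  generalize (decode w : List C).length = d at *
  have b₆ : k * (2 * d + 12) ≤ U * (2 * L + 12) := by gcongr <;> omega
  have b₇ : U * (2 * L + 30) = U * (2 * L + 12) + 18 * U := by ring
  omega

end verify

end LatticeRefutability

namespace LatticeRefutability

/-! ### Duality and nodes -/

/-- The dual operation. -/
def NodeOp.dual : NodeOp → NodeOp
  | .var => .var
  | .zero => .one
  | .one => .zero
  | .join => .meet
  | .meet => .join

/-- The dual node. -/
def Node.dual (R : Node) : Node := ⟨R.op.dual, R.x, R.y, R.z⟩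

namespace BLatTerm

/-- The dual term. -/
def dual : BLatTerm → BLatTerm
  | var n => var n
  | zero => one
  | one => zero
  | join t s => meet t.dual s.dual
  | meet t s => join t.dual s.dual

theorem dual_dual (t : BLatTerm) : t.dual.dual = t := by
  induction t <;> simp_all [dual]

theorem ops_dual (t : BLatTerm) : t.dual.ops = t.ops := by
  induction t <;> simp_all [dual, ops]

/-- Names and arguments stay the same under duality, so a single list of nodes indexes both the
vectors and the functionals. -/
theorem nodes_dual (t : BLatTerm) : ∀ c, t.dual.nodes c = (t.nodes c).map Node.dual := by
  induction t <;> intro c <;> simp_all [dual, nodes, ops_dual, Node.dual, NodeOp.dual]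

/-- The name of a node and the names of its arguments belong to the term. -/
theorem name_mem_of_mem_nodes (t : BLatTerm) : ∀ {c : ℕ} {R : Node}, R ∈ t.nodes c →
    (c ≤ R.y ∧ R.y ≤ c + t.ops) ∧ (R.op = .join ∨ R.op = .meet →
      (c ≤ R.x ∧ R.x ≤ c + t.ops) ∧ c ≤ R.z ∧ R.z ≤ c + t.ops) := by
  induction t with
  | var n | zero | one =>
    intro c R hR
    simp only [nodes, List.mem_singleton] at hR
    subst hR
    simp
  | join t s iht ihs | meet t s iht ihs =>
    intro c R hR
    simp only [nodes, List.mem_cons, List.mem_append, ops] at *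
    obtain rfl | hR | hR := hR
    · simp only; omega
    · have := iht hR
      refine ⟨by omega, fun h => ?_⟩
      have := this.2 h
      omega
    · have := ihs hR
      refine ⟨by omega, fun h => ?_⟩
      have := this.2 h
      omega

/-- Every name of a term belongs to a node. -/
theorem exists_mem_nodes (t : BLatTerm) : ∀ {c n : ℕ}, c ≤ n → n ≤ c + t.ops →
    ∃ R ∈ t.nodes c, R.y = n := by
  induction t with
  | var _ | zero | one =>
    intro c n h₁ h₂
    simp only [ops] at h₂
    simp only [nodes, List.mem_singleton, exists_eq_left]
    omega
  | join t s iht ihs | meet t s iht ihs =>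
    intro c n h₁ h₂
    simp only [nodes, List.mem_cons, List.mem_append, ops] at *
    by_cases h : n ≤ c + s.ops
    · obtain ⟨R, hR, rfl⟩ := ihs h₁ h
      exact ⟨R, .inr (.inr hR), rfl⟩
    by_cases h' : n ≤ c + s.ops + 1 + t.ops
    · obtain ⟨R, hR, rfl⟩ := iht (by omega) h'
      exact ⟨R, .inr (.inl hR), rfl⟩
    · exact ⟨_, .inl rfl, by simp only; omega⟩

/-- Names start at the length of the input. Variable indices lie below it, so the entries used as
equality test never collide with entries at nodes. -/
theorem var_lt_of_mem_nodes (t : BLatTerm) : ∀ {c : ℕ} {R : Node}, R ∈ t.nodes c →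
    R.op = .var → R.x < t.encode.length := by
  induction t with
  | var n | zero | one =>
    intro c R hR
    simp only [nodes, List.mem_singleton] at hR
    subst hR
    simp [encode]
  | join t s iht ihs | meet t s iht ihs =>
    intro c R hR h
    simp only [nodes, List.mem_cons, List.mem_append, encode, List.length_cons,
      List.length_append] at *
    obtain rfl | hR | hR := hR
    · simp at h
    · have := iht hR h; omega
    · have := ihs hR h; omega

end BLatTerm

/-! ### Vectors at nodes -/

section Row

variable {W : Type*} [AddCommGroup W]

/-- The condition for the vectors at a node and at its arguments. -/
def Node.Row (P : ℕ → W → Prop) (w : ℕ → W) (R : Node) : Prop :=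
  match R.op with
  | .var => P R.x (w R.y)
  | .zero => w R.y = 0
  | .one => True
  | .join => w R.y = w R.x + w R.z
  | .meet => w R.y = w R.x ∧ w R.y = w R.z

theorem Node.Row.congr {P : ℕ → W → Prop} {w w' : ℕ → W} {R : Node} (h : R.Row P w)
    (hy : w' R.y = w R.y)
    (hxz : R.op = .join ∨ R.op = .meet → w' R.x = w R.x ∧ w' R.z = w R.z) : R.Row P w' := by
  obtain ⟨o, x, y, z⟩ := R
  cases o <;> simp_all [Node.Row]
  exact h.1.symm.trans h.2

theorem Node.Row.congr_of_mem {P : ℕ → W → Prop} {w w' : ℕ → W} {t : BLatTerm} {c : ℕ} {R : Node}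
    (h : R.Row P w) (hR : R ∈ t.nodes c) (hw : ∀ n, c ≤ n → n ≤ c + t.ops → w' n = w n) :
    R.Row P w' := by
  have := t.name_mem_of_mem_nodes hR
  refine h.congr (hw _ this.1.1 this.1.2) fun h' => ?_
  have := this.2 h'
  exact ⟨hw _ this.1.1 this.1.2, hw _ this.2.1 this.2.2⟩

/-- A relation between terms and vectors that is compatible with the operations like membership
in a subspace. -/
structure Membership (G : BLatTerm → W → Prop) : Prop where
  join : ∀ {t s v}, G (.join t s) v ↔ ∃ a b, G t a ∧ G s b ∧ v = a + b
  meet : ∀ {t s v}, G (.meet t s) v ↔ G t v ∧ G s v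
  zero : ∀ {v}, G .zero v ↔ v = 0
  one : ∀ v, G .one v

variable {G : BLatTerm → W → Prop}

/-- Soundness of the certificates: the conditions propagate membership from the leaves up to the
root, whose name is `c + t.ops`. -/
theorem Membership.of_rows (hG : Membership G) {w : ℕ → W} (t : BLatTerm) : ∀ {c : ℕ},
    (∀ R ∈ t.nodes c, R.Row (fun n => G (.var n)) w) → G t (w (c + t.ops)) := by
  induction t with
  | var n => intro c h; exact h _ (List.mem_singleton_self _)
  | zero => intro c h; exact hG.zero.2 (h _ (List.mem_singleton_self _))
  | one => intro c _; exact hG.one _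
  | join t s iht ihs =>
    intro c h
    simp only [BLatTerm.nodes, List.mem_cons, List.mem_append] at h
    have h₁ := h _ (.inl rfl)
    rw [show c + (t.join s).ops = c + s.ops + 1 + t.ops + 1 by simp [BLatTerm.ops]; omega]
    exact hG.join.2 ⟨_, _, iht fun R hR => h R (.inr (.inl hR)),
      ihs fun R hR => h R (.inr (.inr hR)), h₁⟩
  | meet t s iht ihs =>
    intro c h
    simp only [BLatTerm.nodes, List.mem_cons, List.mem_append] at h
    obtain ⟨h₁, h₂⟩ := h _ (.inl rfl)
    simp only at h₁ h₂
    rw [show c + (t.meet s).ops = c + s.ops + 1 + t.ops + 1 by simp [BLatTerm.ops]; omega]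
    refine hG.meet.2 ⟨?_, ?_⟩
    · rw [h₁]
      exact iht fun R hR => h R (.inr (.inl hR))
    · rw [h₂]
      exact ihs fun R hR => h R (.inr (.inr hR))

/-- The names of the two terms fill disjoint intervals and the next name is free for a common root,
so a definition by cases works. -/
theorem exists_glue (P : ℕ → W → Prop) {t s : BLatTerm} {c : ℕ} {w₁ w₂ : ℕ → W}
    (h₁ : ∀ R ∈ t.nodes (c + s.ops + 1), R.Row P w₁) (h₂ : ∀ R ∈ s.nodes c, R.Row P w₂) (v : W) :
    ∃ w : ℕ → W, w (c + s.ops + 1 + t.ops + 1) = v ∧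
      w (c + s.ops + 1 + t.ops) = w₁ (c + s.ops + 1 + t.ops) ∧ w (c + s.ops) = w₂ (c + s.ops) ∧
      ∀ R ∈ pairNodes (t, s) c, R.Row P w := by
  refine ⟨fun n => if n ≤ c + s.ops then w₂ n else if n ≤ c + s.ops + 1 + t.ops then w₁ n else v,
    ?_, ?_, ?_, fun R hR => ?_⟩
  · beta_reduce
    rw [if_neg (by omega), if_neg (by omega)]
  · beta_reduce
    rw [if_neg (by omega), if_pos le_rfl]
  · exact if_pos le_rfl
  · obtain hR | hR := List.mem_append.1 hR
    · refine (h₁ R hR).congr_of_mem hR fun n hn hn' => ?_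
      rw [if_neg (by simp only at *; omega), if_pos hn']
    · refine (h₂ R hR).congr_of_mem hR fun n hn hn' => ?_
      rw [if_pos hn']

/-- Completeness of the certificates: at every join the vector is split into summands, at every meet
it is handed to both arguments. -/
theorem Membership.exists_rows (hG : Membership G) (t : BLatTerm) : ∀ (c : ℕ) {v : W}, G t v →
    ∃ w : ℕ → W, w (c + t.ops) = v ∧ ∀ R ∈ t.nodes c, R.Row (fun n => G (.var n)) w := by
  induction t with
  | var n =>
    intro c v hv
    refine ⟨fun _ => v, rfl, fun R hR => ?_⟩
    rw [List.mem_singleton.1 hR]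
    exact hv
  | zero =>
    intro c v hv
    refine ⟨fun _ => v, rfl, fun R hR => ?_⟩
    rw [List.mem_singleton.1 hR]
    exact hG.zero.1 hv
  | one =>
    intro c v hv
    refine ⟨fun _ => v, rfl, fun R hR => ?_⟩
    rw [List.mem_singleton.1 hR]
    trivial
  | join t s iht ihs =>
    intro c v hv
    obtain ⟨a, b, ha, hb, rfl⟩ := hG.join.1 hv
    obtain ⟨w₁, h₁, h₁'⟩ := iht (c + s.ops + 1) ha
    obtain ⟨w₂, h₂, h₂'⟩ := ihs c hb
    obtain ⟨w, e₀, e₁, e₂, h⟩ := exists_glue _ h₁' h₂' (a + b)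
    refine ⟨w, ?_, fun R hR => ?_⟩
    · rw [← e₀]; congr 1; simp only [BLatTerm.ops]; omega
    · obtain rfl | hR := List.mem_cons.1 hR
      · simp only [Node.Row]
        rw [e₀, e₁, e₂, h₁, h₂]
      · exact h R hR
  | meet t s iht ihs =>
    intro c v hv
    obtain ⟨ha, hb⟩ := hG.meet.1 hv
    obtain ⟨w₁, h₁, h₁'⟩ := iht (c + s.ops + 1) ha
    obtain ⟨w₂, h₂, h₂'⟩ := ihs c hb
    obtain ⟨w, e₀, e₁, e₂, h⟩ := exists_glue _ h₁' h₂' v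
    refine ⟨w, ?_, fun R hR => ?_⟩
    · rw [← e₀]; congr 1; simp only [BLatTerm.ops]; omega
    · obtain rfl | hR := List.mem_cons.1 hR
      · simp only [Node.Row]
        rw [e₀, e₁, e₂, h₁, h₂]
        exact ⟨rfl, rfl⟩
      · exact h R hR

theorem Membership.exists_pair_rows (hG : Membership G) (e : BLatTerm × BLatTerm) (c : ℕ)
    {v₁ v₂ : W} (h₁ : G e.1 v₁) (h₂ : G e.2 v₂) :
    ∃ w : ℕ → W, w (c + e.2.ops + 1 + e.1.ops) = v₁ ∧ w (c + e.2.ops) = v₂ ∧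
      ∀ R ∈ pairNodes e c, R.Row (fun n => G (.var n)) w := by
  obtain ⟨w₁, h₁, h₁'⟩ := hG.exists_rows e.1 (c + e.2.ops + 1) h₁
  obtain ⟨w₂, h₂, h₂'⟩ := hG.exists_rows e.2 c h₂
  obtain ⟨w, -, e₁, e₂, h⟩ := exists_glue _ h₁' h₂' 0
  exact ⟨w, e₁.trans h₁, e₂.trans h₂, h⟩

end Row

/-! ### The meaning of the equations -/

section Equations

variable {C : Type*} [CommRing C]

/-- The row condition of `R` is imposed in the column of `R'`, and the dual condition of `R'` in the
row of `R`. Leaves get the trivial predicate here, since membership in the subspace of a variable is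
encoded by the last two conditions. -/
theorem nodeEqs_iff (r : ℕ → C) (m : ℕ) (R R' : Node) :
    (∀ τ ∈ nodeEqs m R R', τ.eval r = 0) ↔
      (R.Row (fun _ _ => True) fun a => r (a * m + R'.y)) ∧
      (R'.dual.Row (fun _ _ => True) fun b => r (R.y * m + b)) ∧
      (R.op = .var → r (R.x * m + R.x) = 1) ∧
      (R.op = .var → R'.op = .var → r (R.y * m + R'.y) * r (R.x * m + R'.x) = 0) := by
  obtain ⟨o, x, y, z⟩ := R
  obtain ⟨o', x', y', z'⟩ := R'
  cases o <;> cases o' <;>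
    simp [nodeEqs, pairEqs, rowEqs, colEqs, varEqs, Template.inst, RingTerm.eval, regs, Node.Row,
      Node.dual, NodeOp.dual, sub_eq_zero, and_assoc] <;>
    tauto

theorem pairSystem_iff (r : ℕ → C) (e : BLatTerm × BLatTerm) (c : ℕ) {M : ℕ}
    (hM : M = c + e.2.ops + 1 + e.1.ops + 1) :
    (∀ τ ∈ pairSystem e c, τ.eval r = 0) ↔
      (∀ R ∈ pairNodes e c, ∀ R' ∈ pairNodes e c, ∀ τ ∈ nodeEqs M R R', τ.eval r = 0) ∧
      r ((c + e.2.ops + 1 + e.1.ops) * M + (c + e.2.ops)) +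
        r ((c + e.2.ops) * M + (c + e.2.ops + 1 + e.1.ops)) = 1 := by
  subst hM
  simp only [pairSystem, rowNodeEqs, List.mem_append, List.mem_flatMap, List.mem_reverse,
    List.mem_singleton, or_imp, forall_and, forall_eq, rootTemplate, Template.inst, RingTerm.eval,
    regs, sub_eq_zero]
  refine and_congr_left' ⟨fun h R hR R' hR' τ hτ => h τ ⟨R, hR, R', hR', hτ⟩, ?_⟩
  rintro h τ ⟨R, hR, R', hR', hτ⟩
  exact h R hR R' hR' τ hτ

end Equations

theorem name_mem_of_mem_pairNodes {e : BLatTerm × BLatTerm} {c : ℕ} {R : Node}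
    (hR : R ∈ pairNodes e c) :
    (c ≤ R.y ∧ R.y ≤ c + e.2.ops + 1 + e.1.ops) ∧ (R.op = .join ∨ R.op = .meet →
      (c ≤ R.x ∧ R.x ≤ c + e.2.ops + 1 + e.1.ops) ∧
        c ≤ R.z ∧ R.z ≤ c + e.2.ops + 1 + e.1.ops) := by
  obtain hR | hR := List.mem_append.1 hR
  · have h₁ := e.1.name_mem_of_mem_nodes hR
    refine ⟨by omega, fun h => ?_⟩
    have := h₁.2 h
    omega
  · have h₁ := e.2.name_mem_of_mem_nodes hR
    refine ⟨by omega, fun h => ?_⟩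
    have := h₁.2 h
    omega

theorem exists_mem_pairNodes {e : BLatTerm × BLatTerm} {c n : ℕ} (h₁ : c ≤ n)
    (h₂ : n ≤ c + e.2.ops + 1 + e.1.ops) : ∃ R ∈ pairNodes e c, R.y = n := by
  by_cases h : n ≤ c + e.2.ops
  · obtain ⟨R, hR, rfl⟩ := e.2.exists_mem_nodes h₁ h
    exact ⟨R, List.mem_append_right _ hR, rfl⟩
  · obtain ⟨R, hR, rfl⟩ := e.1.exists_mem_nodes (c := c + e.2.ops + 1) (by omega) h₂
    exact ⟨R, List.mem_append_left _ hR, rfl⟩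

theorem var_lt_of_mem_pairNodes {e : BLatTerm × BLatTerm} {c : ℕ} {R : Node}
    (hR : R ∈ pairNodes e c) (h : R.op = .var) : R.x < (BLatTerm.encodePair e).length := by
  simp only [BLatTerm.encodePair, List.length_append]
  obtain hR | hR := List.mem_append.1 hR
  · have := e.1.var_lt_of_mem_nodes hR h; omega
  · have := e.2.var_lt_of_mem_nodes hR h; omega

end LatticeRefutability

namespace LatticeRefutability

/-! ### Subspaces and vectors -/

section Subspaces

variable {k : Type*} [Field k] {V : Type*} [AddCommGroup V] [Module k V]

theorem membership_mem (a : ℕ → Submodule k V) : Membership fun t v => v ∈ t.eval a where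
  join := by
    intro t s v
    simp only [BLatTerm.eval, Submodule.mem_sup]
    exact ⟨fun ⟨x, hx, y, hy, h⟩ => ⟨x, y, hx, hy, h.symm⟩,
      fun ⟨x, y, hx, hy, h⟩ => ⟨x, hx, y, hy, h.symm⟩⟩
  meet := Iff.rfl
  zero := Iff.rfl
  one _ := trivial

/-- Annihilators exchange sums and intersections. The dual term appears so that a join still
corresponds to a sum, now of functionals. -/
theorem membership_le_ker (a : ℕ → Submodule k V) :
    Membership fun t (φ : Module.Dual k V) => t.dual.eval a ≤ LinearMap.ker φ where
  join := by
    intro t s φ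
    simp only [BLatTerm.dual, BLatTerm.eval]
    constructor
    · intro h
      have h' : φ ∈ (t.dual.eval a ⊓ s.dual.eval a).dualAnnihilator :=
        (Submodule.mem_dualAnnihilator φ).2 fun v hv => h hv
      -- A functional that vanishes on an intersection of subspaces is a sum of functionals that
      -- vanish on one each, in any dimension.
      rw [Subspace.dualAnnihilator_inf_eq, Submodule.mem_sup] at h'
      obtain ⟨x, hx, y, hy, h⟩ := h'
      exact ⟨x, y, fun v hv => (Submodule.mem_dualAnnihilator x).1 hx v hv,
        fun v hv => (Submodule.mem_dualAnnihilator y).1 hy v hv, h.symm⟩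
    · rintro ⟨x, y, hx, hy, rfl⟩ v ⟨h₁, h₂⟩
      have h₁ : x v = 0 := hx h₁
      have h₂ : y v = 0 := hy h₂
      simp [h₁, h₂]
  meet := by intro t s φ; exact sup_le_iff
  zero := by
    intro φ
    simp [BLatTerm.dual, BLatTerm.eval, top_le_iff, LinearMap.ker_eq_top]
  one φ := by simp [BLatTerm.dual, BLatTerm.eval]

/-- Vectors and functionals at the nodes of a pair of terms give rise to a solution of the
equations. -/
theorem exists_solution (a : ℕ → Submodule k V) (e : BLatTerm × BLatTerm) {v₁ v₂ : V}
    {φ₁ φ₂ : Module.Dual k V} (hv₁ : v₁ ∈ e.1.eval a) (hv₂ : v₂ ∈ e.2.eval a)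
    (hφ₁ : e.1.eval a ≤ LinearMap.ker φ₁) (hφ₂ : e.2.eval a ≤ LinearMap.ker φ₂)
    (h : φ₂ v₁ + φ₁ v₂ = 1) : ∃ r : ℕ → k, ∀ τ ∈ system e, τ.eval r = 0 := by
  set c := (BLatTerm.encodePair e).length with hc
  obtain ⟨M, hM⟩ : ∃ M, M = c + e.2.ops + 1 + e.1.ops + 1 := ⟨_, rfl⟩
  obtain ⟨w, hw₁, hw₂, hw⟩ := (membership_mem a).exists_pair_rows e c hv₁ hv₂
  obtain ⟨φ, hφ₁, hφ₂, hφ⟩ := (membership_le_ker a).exists_pair_rows (e.1.dual, e.2.dual) c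
    (v₁ := φ₁) (v₂ := φ₂) (by rwa [BLatTerm.dual_dual]) (by rwa [BLatTerm.dual_dual])
  simp only [BLatTerm.ops_dual] at hφ₁ hφ₂
  replace hφ : ∀ R ∈ pairNodes e c,
      R.dual.Row (fun n φ => a n ≤ LinearMap.ker φ) φ := by
    intro R hR
    refine hφ _ ?_
    simp only [pairNodes, BLatTerm.nodes_dual, BLatTerm.ops_dual, ← List.map_append]
    exact List.mem_map_of_mem hR
  -- Rows below `c` form the identity matrix, for testing equality of variables; the other rows
  -- contain the values of the functionals on the vectors.
  obtain ⟨g, hg⟩ : ∃ g : ℕ → ℕ → k, ∀ i j, g i j =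
    if i < c then if i = j then 1 else 0 else φ j (w i) := ⟨_, fun _ _ => rfl⟩
  have hge : ∀ {i} j, c ≤ i → g i j = φ j (w i) := fun j hi => by rw [hg, if_neg (by omega)]
  have hr : ∀ {i j}, j < M → g ((i * M + j) / M) ((i * M + j) % M) = g i j := by
    intro i j hj
    rw [Nat.mul_comm, Nat.mul_add_mod, Nat.mod_eq_of_lt hj, Nat.mul_add_div (by omega),
      Nat.div_eq_of_lt hj, Nat.add_zero]
  refine ⟨fun n => g (n / M) (n % M), (pairSystem_iff _ e c hM).2 ⟨fun R hR R' hR' => ?_, ?_⟩⟩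
  · have hy := name_mem_of_mem_pairNodes hR
    have hy' := name_mem_of_mem_pairNodes hR'
    refine (nodeEqs_iff _ _ _ _).2 ⟨?_, ?_, fun hx => ?_, fun hx hx' => ?_⟩
    · have := hw R hR
      obtain ⟨o, x, y, z⟩ := R
      cases o <;> simp only [Node.Row, NodeOp.dual, Node.dual, reduceCtorEq, or_true, or_false,
        forall_const, IsEmpty.forall_iff] at * <;> try trivial
      · rw [hr (by omega), hge _ (by omega), this, map_zero]
      · rw [hr (by omega), hr (by omega), hr (by omega), hge _ (by omega), hge _ (by omega),
          hge _ (by omega), this, map_add]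
      · rw [hr (by omega), hr (by omega), hr (by omega), hge _ (by omega), hge _ (by omega),
          hge _ (by omega), ← this.1, ← this.2]
        exact ⟨rfl, rfl⟩
    · have := hφ R' hR'
      obtain ⟨o, x, y, z⟩ := R'
      cases o <;> simp only [Node.Row, NodeOp.dual, Node.dual, reduceCtorEq, or_true, or_false,
        forall_const, IsEmpty.forall_iff] at * <;> try trivial
      · rw [hr (by omega), hge _ (by omega), this, LinearMap.zero_apply]
      · rw [hr (by omega), hr (by omega), hr (by omega), hge _ (by omega), hge _ (by omega),
          hge _ (by omega), ← this.1, ← this.2]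
        exact ⟨rfl, rfl⟩
      · rw [hr (by omega), hr (by omega), hr (by omega), hge _ (by omega), hge _ (by omega),
          hge _ (by omega), this, LinearMap.add_apply]
    · have := var_lt_of_mem_pairNodes hR hx
      rw [hr (by omega), hg, if_pos (by omega), if_pos rfl]
    · have h₁ := var_lt_of_mem_pairNodes hR hx
      have h₂ := var_lt_of_mem_pairNodes hR' hx'
      rw [hr (by omega), hr (by omega), hge _ (by omega), hg, if_pos (by omega)]
      -- For the same variable, the vector lies in the subspace on which the functional vanishes;
      -- otherwise the off-diagonal factor is 0.
      split_ifs with h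
      · have h₃ := hw R hR
        have h₄ := hφ R' hR'
        simp only [Node.Row, Node.dual, hx, hx', NodeOp.dual, ← h] at h₃ h₄
        rw [show φ R'.y (w R.y) = 0 from h₄ h₃, zero_mul]
      · rw [mul_zero]
  · rw [hr (by omega), hr (by omega), hge _ (by omega), hge _ (by omega), hw₁, hw₂, hφ₁, hφ₂, h]

/-- Of two distinct subspaces, one is not contained in the other, and a functional separates them.
The unused vector and functional are 0, so the root equation covers both directions. -/
theorem exists_solution_of_ne (a : ℕ → Submodule k V) (e : BLatTerm × BLatTerm)
    (h : e.1.eval a ≠ e.2.eval a) : ∃ r : ℕ → k, ∀ τ ∈ system e, τ.eval r = 0 := by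
  have key : ∀ {A B : Submodule k V}, ¬ A ≤ B →
      ∃ v ∈ A, ∃ φ : Module.Dual k V, B ≤ LinearMap.ker φ ∧ φ v = 1 := by
    intro A B hAB
    obtain ⟨v, hv, hv'⟩ := SetLike.not_le_iff_exists.1 hAB
    obtain ⟨φ, hφ, hφ'⟩ := B.exists_le_ker_of_notMem hv'
    refine ⟨v, hv, (φ v)⁻¹ • φ, fun x hx => ?_, ?_⟩
    · simp [show φ x = 0 from hφ' hx]
    · simp [hφ]
  by_cases h₁ : e.1.eval a ≤ e.2.eval a
  · obtain ⟨v, hv, φ, hφ, h'⟩ := key fun h₂ => h (le_antisymm h₁ h₂)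
    exact exists_solution a e (v₁ := 0) (φ₂ := 0) (zero_mem _) hv hφ (by simp) (by simp [h'])
  · obtain ⟨v, hv, φ, hφ, h'⟩ := key h₁
    exact exists_solution a e (v₂ := 0) (φ₁ := 0) hv (zero_mem _) (by simp) hφ (by simp [h'])

end Subspaces

end LatticeRefutability

namespace LatticeRefutability

/-! ### From a solution to a failing identity -/

section Subspaces

variable {k : Type*} [Field k]

/-- The space of all vectors that satisfy the conditions for the columns of the given nodes. -/
def columnSpace (N : List Node) : Submodule k (ℕ → k) where
  carrier := {f | ∀ R ∈ N, R.dual.Row (fun _ _ => True) f}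
  zero_mem' := by
    rintro ⟨o, x, y, z⟩ -
    cases o <;> simp [Node.Row, Node.dual, NodeOp.dual]
  add_mem' := by
    rintro f g hf hg R hR
    have hf := hf R hR
    have hg := hg R hR
    obtain ⟨o, x, y, z⟩ := R
    cases o <;> simp only [Node.Row, Node.dual, NodeOp.dual, Pi.add_apply] at * <;> try trivial
    · rw [hf, hg, add_zero]
    · rw [← hf.1, ← hf.2, ← hg.1, ← hg.2]
      exact ⟨rfl, rfl⟩
    · rw [hf, hg]
      abel
  smul_mem' := by
    rintro c f hf R hR
    have hf := hf R hR
    obtain ⟨o, x, y, z⟩ := R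
    cases o <;> simp only [Node.Row, Node.dual, NodeOp.dual, Pi.smul_apply, smul_eq_mul] at * <;>
      try trivial
    · rw [hf, mul_zero]
    · rw [← hf.1, ← hf.2]
      exact ⟨rfl, rfl⟩
    · rw [hf, mul_add]

theorem exists_ne_of_solution (e : BLatTerm × BLatTerm) {r : ℕ → k}
    (h : ∀ τ ∈ system e, τ.eval r = 0) :
    ∃ (V : Submodule k (ℕ → k)) (a : ℕ → Submodule k V), e.1.eval a ≠ e.2.eval a := by
  classical
  set c := (BLatTerm.encodePair e).length with hc
  obtain ⟨M, hM⟩ : ∃ M, M = c + e.2.ops + 1 + e.1.ops + 1 := ⟨_, rfl⟩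
  obtain ⟨h, hroot⟩ := (pairSystem_iff r e c hM).1 h
  set N := pairNodes e c
  replace h := fun R hR R' hR' => (nodeEqs_iff _ _ _ _).1 (h R hR R' hR')
  -- The row equations are known only in columns that are names. Cutting off the other coordinates
  -- turns them into equations between vectors.
  obtain ⟨g, hg⟩ : ∃ g : ℕ → ℕ → k, ∀ i j, g i j = if c ≤ j ∧ j < M then r (i * M + j) else 0 :=
    ⟨_, fun _ _ => rfl⟩
  have hgr : ∀ i {j}, c ≤ j → j < M → g i j = r (i * M + j) :=
    fun i j h₁ h₂ => by rw [hg, if_pos ⟨h₁, h₂⟩]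
  have hcol : ∀ R ∈ N, g R.y ∈ columnSpace (k := k) N := by
    intro R hR R' hR'
    have h₁ := name_mem_of_mem_pairNodes hR'
    refine (h R hR R' hR').2.1.congr (hgr _ (by simp only [Node.dual]; omega)
      (by simp only [Node.dual]; omega)) fun h₂ => ?_
    have h₂ := h₁.2 (by cases h : R'.op <;> simp_all [Node.dual, NodeOp.dual])
    exact ⟨hgr _ (by simp only [Node.dual]; omega) (by simp only [Node.dual]; omega),
      hgr _ (by simp only [Node.dual]; omega) (by simp only [Node.dual]; omega)⟩
  have hcol' : ∀ {i}, c ≤ i → i < M → g i ∈ columnSpace (k := k) N := by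
    intro i h₁ h₂
    obtain ⟨R, hR, rfl⟩ := exists_mem_pairNodes (e := e) h₁ (by omega)
    exact hcol R hR
  let w : ℕ → columnSpace (k := k) N := fun i =>
    if h : c ≤ i ∧ i < M then ⟨g i, hcol' h.1 h.2⟩ else 0
  have hw : ∀ {i}, c ≤ i → i < M → ∀ j, (w i : ℕ → k) j = g i j :=
    fun h₁ h₂ j => by simp only [w, dif_pos (And.intro h₁ h₂)]
  let φ : ℕ → Module.Dual k (columnSpace (k := k) N) :=
    fun j => LinearMap.proj j ∘ₗ (columnSpace N).subtype
  -- The smallest choice that makes the row conditions hold at the leaves; the column conditions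
  -- there then need checking only on generators.
  let a : ℕ → Submodule k (columnSpace (k := k) N) :=
    fun n => Submodule.span k {v | ∃ R ∈ N, R.op = .var ∧ R.x = n ∧ w R.y = v}
  have hrow : ∀ R ∈ N, R.Row (fun n v => v ∈ a n) w := by
    intro R hR
    have hy := name_mem_of_mem_pairNodes hR
    have key : ∀ j, c ≤ j → j < M → R.Row (fun _ _ => True) fun i => g i j := by
      intro j h₁ h₂
      obtain ⟨R', hR', rfl⟩ := exists_mem_pairNodes (e := e) h₁ (by omega)
      simpa only [hgr _ h₁ h₂] using (h R hR R' hR').1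
    have hzero : ∀ i j, ¬ (c ≤ j ∧ j < M) → g i j = 0 := fun i j h => by rw [hg, if_neg h]
    have mem : R.op = .var → w R.y ∈ a R.x := fun h => Submodule.subset_span ⟨R, hR, h, rfl, rfl⟩
    obtain ⟨o, x, y, z⟩ := R
    cases o <;> simp only [Node.Row, reduceCtorEq, or_true, or_false, forall_const,
      IsEmpty.forall_iff] at *
    · exact mem
    · ext j
      by_cases hj : c ≤ j ∧ j < M
      · simpa [hw (i := y) (by omega) (by omega)] using key j hj.1 hj.2
      · simpa [hw (i := y) (by omega) (by omega)] using hzero y j hj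
    · ext j
      by_cases hj : c ≤ j ∧ j < M
      · simpa [hw (i := y) (by omega) (by omega), hw (i := x) (by omega) (by omega),
          hw (i := z) (by omega) (by omega)] using key j hj.1 hj.2
      · simp [hw (i := y) (by omega) (by omega), hw (i := x) (by omega) (by omega),
          hw (i := z) (by omega) (by omega), hzero _ j hj]
    · refine ⟨?_, ?_⟩ <;> ext j <;> by_cases hj : c ≤ j ∧ j < M
      · simpa [hw (i := y) (by omega) (by omega), hw (i := x) (by omega) (by omega)]
          using (key j hj.1 hj.2).1
      · simp [hw (i := y) (by omega) (by omega), hw (i := x) (by omega) (by omega), hzero _ j hj]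
      · simpa [hw (i := y) (by omega) (by omega), hw (i := z) (by omega) (by omega)]
          using (key j hj.1 hj.2).2
      · simp [hw (i := y) (by omega) (by omega), hw (i := z) (by omega) (by omega), hzero _ j hj]
  have hrow' : ∀ R ∈ N, R.dual.Row (fun n φ => a n ≤ LinearMap.ker φ) φ := by
    intro R' hR'
    have hy' := name_mem_of_mem_pairNodes hR'
    -- The relations between the coordinate functionals hold because they define the space.
    have key : ∀ v : columnSpace (k := k) N, R'.dual.Row (fun _ _ => True) (v : ℕ → k) :=
      fun v => v.2 R' hR'
    have mem : R'.op = .var → a R'.x ≤ LinearMap.ker (φ R'.y) := by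
      intro hx'
      refine Submodule.span_le.2 ?_
      rintro _ ⟨R, hR, hx, hxx, rfl⟩
      have hy := name_mem_of_mem_pairNodes hR
      have h₁ := (h R hR R' hR').2.2
      -- Both leaves carry the same variable, so the second factor is the diagonal entry 1 and the
      -- entry of the leaves is zero.
      rw [← hxx, h₁.1 hx, mul_one] at h₁
      change (w R.y : ℕ → k) R'.y = 0
      rw [hw (by omega) (by omega), hgr _ (by omega) (by omega)]
      exact h₁.2 hx hx'
    obtain ⟨o, x, y, z⟩ := R'
    cases o <;> simp only [Node.Row, Node.dual, NodeOp.dual, forall_const, reduceCtorEq,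
      IsEmpty.forall_iff] at * <;> try trivial
    · ext v; exact key v
    · exact ⟨LinearMap.ext fun v => (key v).1, LinearMap.ext fun v => (key v).2⟩
    · ext v; exact key v
  refine ⟨columnSpace N, a, fun heq => ?_⟩
  have hφ : ∀ R ∈ pairNodes (e.1.dual, e.2.dual) c, R.Row (fun n φ => a n ≤ LinearMap.ker φ) φ := by
    simp only [pairNodes, BLatTerm.nodes_dual, BLatTerm.ops_dual, ← List.map_append, List.mem_map]
    rintro _ ⟨R, hR, rfl⟩
    exact hrow' R hR
  have h₁ := (membership_mem a).of_rows e.1 fun R hR => hrow R (List.mem_append_left _ hR)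
  have h₂ := (membership_mem a).of_rows e.2 fun R hR => hrow R (List.mem_append_right _ hR)
  have h₃ := (membership_le_ker a).of_rows e.1.dual fun R hR => hφ R (List.mem_append_left _ hR)
  have h₄ := (membership_le_ker a).of_rows e.2.dual fun R hR => hφ R (List.mem_append_right _ hR)
  simp only [BLatTerm.dual_dual, BLatTerm.ops_dual] at h₃ h₄
  have h₅ := h₄ (heq ▸ h₁)
  have h₆ := h₃ (heq ▸ h₂)
  change (w _ : ℕ → k) _ = 0 at h₅ h₆
  rw [hw (by omega) (by omega), hgr _ (by omega) (by omega)] at h₅ h₆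
  rw [h₅, h₆, add_zero] at hroot
  exact zero_ne_one hroot

end Subspaces

end LatticeRefutability

universe v

namespace LatticeRefutability

/-! ### Division rings and prime fields -/

theorem BLatTerm.eval_map {A B : Type*} [Lattice A] [BoundedOrder A] [Lattice B] [BoundedOrder B]
    (f : BoundedLatticeHom A B) (a : ℕ → A) (t : BLatTerm) :
    t.eval (fun n => f (a n)) = f (t.eval a) := by
  induction t with
  | var n => rfl
  | zero => exact (map_bot f).symm
  | one => exact (map_top f).symm
  | join t s iht ihs => simp only [eval, iht, ihs, map_sup]
  | meet t s iht ihs => simp only [eval, iht, ihs, map_inf]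

theorem RingTerm.eval_map {R S : Type*} [Ring R] [Ring S] (f : R →+* S) (r : ℕ → R)
    (t : RingTerm) : t.eval (fun n => f (r n)) = f (t.eval r) := by
  induction t <;> simp_all [eval]

/-- An identity for lattices fails for the subspaces of a vector space over a division ring of
characteristic `p`. -/
def FailsInChar (p : ℕ) (e : BLatTerm × BLatTerm) : Prop :=
  ∃ (F V : Type u) (_ : DivisionRing F) (_ : CharP F p) (_ : AddCommGroup V) (_ : Module F V)
    (a : ℕ → Submodule F V), e.1.eval a ≠ e.2.eval a

theorem exists_solution_of_algebra {k : Type} [Field k] {F : Type u} {V : Type v} [DivisionRing F]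
    [Algebra k F] [AddCommGroup V] [Module F V] {a : ℕ → Submodule F V} {e : BLatTerm × BLatTerm}
    (h : e.1.eval a ≠ e.2.eval a) : ∃ r : ℕ → k, ∀ τ ∈ system e, τ.eval r = 0 := by
  let : Module k V := Module.compHom V (algebraMap k F)
  have : IsScalarTower k F V := IsScalarTower.of_algebraMap_smul fun _ _ => rfl
  let f : BoundedLatticeHom (Submodule F V) (Submodule k V) :=
    { toFun := Submodule.restrictScalars k
      map_sup' := Submodule.restrictScalars_sup k
      map_inf' := Submodule.restrictScalars_inf k
      map_top' := Submodule.restrictScalars_top k F V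
      map_bot' := Submodule.restrictScalars_bot k F V }
  refine exists_solution_of_ne (fun n => f (a n)) e fun h' => h ?_
  rw [BLatTerm.eval_map, BLatTerm.eval_map] at h'
  exact Submodule.restrictScalars_injective k F V h'

/-- The field has to be lifted to the universe of the lattices; a ring isomorphism carries the
solution along. -/
theorem failsInChar_of_solution {k : Type} [Field k] {p : ℕ} [CharP k p] {e : BLatTerm × BLatTerm}
    {r : ℕ → k} (h : ∀ τ ∈ system e, τ.eval r = 0) : FailsInChar.{u} p e := by
  obtain ⟨V, a, ha⟩ := exists_ne_of_solution (k := ULift.{u} k) e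
    (r := fun n => ULift.ringEquiv.symm (r n)) fun τ hτ => by
      rw [show τ.eval (fun n => ULift.ringEquiv.symm (r n)) = ULift.ringEquiv.symm (τ.eval r) from
        RingTerm.eval_map (ULift.ringEquiv (R := k)).symm.toRingHom r τ, h τ hτ, map_zero]
  exact ⟨ULift.{u} k, V, inferInstance, ULift.charP _ p, inferInstance, inferInstance, a, ha⟩

theorem failsInChar_zero_iff (e : BLatTerm × BLatTerm) :
    FailsInChar.{u} 0 e ↔ ∃ r : ℕ → ℝ, ∀ τ ∈ system e, τ.eval r = 0 := by
  constructor
  · rintro ⟨F, V, _, _, _, _, a, ha⟩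
    have := CharP.charP_to_charZero F
    obtain ⟨r, hr⟩ := exists_solution_of_algebra (k := ℚ) ha
    refine ⟨fun n => algebraMap ℚ ℝ (r n), fun τ hτ => ?_⟩
    rw [RingTerm.eval_map, hr τ hτ, map_zero]
  · rintro ⟨r, hr⟩
    exact failsInChar_of_solution hr

theorem failsInChar_prime_iff (p : ℕ) [Fact p.Prime] (e : BLatTerm × BLatTerm) :
    FailsInChar.{u} p e ↔ ∃ r : ℕ → ZMod p, ∀ τ ∈ system e, τ.eval r = 0 := by
  constructor
  · rintro ⟨F, V, _, _, _, _, a, ha⟩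
    let := ZMod.algebra F p
    exact exists_solution_of_algebra ha
  · rintro ⟨r, hr⟩
    exact failsInChar_of_solution hr

/-! ### Refutability in the varieties of subspace lattices -/

/-- A lattice term as a term of bounded lattices. -/
def LatTerm.toBounded : LatTerm → BLatTerm
  | var n => .var n
  | join t s => .join t.toBounded s.toBounded
  | meet t s => .meet t.toBounded s.toBounded

theorem LatTerm.encode_toBounded (t : LatTerm) : t.toBounded.encode = t.encode := by
  induction t <;> simp_all [toBounded, encode, BLatTerm.encode]

theorem LatTerm.eval_toBounded {A : Type*} [Lattice A] [BoundedOrder A] (a : ℕ → A)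
    (t : LatTerm) : t.toBounded.eval a = t.eval a := by
  induction t <;> simp_all [toBounded, eval, BLatTerm.eval]

/-- If the identity held in all generating lattices, its models would be a variety that contains
them, hence all of the smallest one. No description of the variety by closure operators is needed.
-/
theorem boundedREF_yes_iff (p : ℕ) (e : BLatTerm × BLatTerm) :
    (boundedREF (boundedSubspaceVariety.{u} p)).Yes e ↔ FailsInChar.{u} p e := by
  constructor
  · rintro ⟨A, _, _, hA, a, ha⟩
    by_contra h
    refine ha (hA (fun B _ _ => ∀ b : ℕ → B, e.1.eval b = e.2.eval b) ⟨{e}, fun B _ _ => ?_⟩ ?_ a)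
    · simp
    · intro F V _ _ _ _ b
      by_contra hb
      exact h ⟨F, V, _, ‹_›, _, _, b, hb⟩
  · rintro ⟨F, V, _, _, _, _, a, ha⟩
    exact ⟨Submodule F V, inferInstance, inferInstance, fun K _ h => h F V, a, ha⟩

theorem REF_yes_iff (p : ℕ) (e : LatTerm × LatTerm) :
    (REF (subspaceVariety.{u} p)).Yes e ↔ FailsInChar.{u} p (e.1.toBounded, e.2.toBounded) := by
  constructor
  · rintro ⟨A, _, hA, a, ha⟩
    by_contra h
    refine ha (hA (fun B _ => ∀ b : ℕ → B, e.1.eval b = e.2.eval b) ⟨{e}, fun B _ => ?_⟩ ?_ a)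
    · simp
    · intro F V _ _ _ _ b
      by_contra hb
      exact h ⟨F, V, _, ‹_›, _, _, b, by simpa only [LatTerm.eval_toBounded] using hb⟩
  · rintro ⟨F, V, _, _, _, _, a, ha⟩
    simp only [LatTerm.eval_toBounded] at ha
    exact ⟨Submodule F V, inferInstance, fun K _ h => h F V, a, ha⟩

/-! ### Certificates -/

/-- Indices are written in unary, so the length of a term exceeds every index that occurs in it. -/
theorem RingTerm.eval_congr {R : Type*} [Ring R] {r r' : ℕ → R} (t : RingTerm)
    (h : ∀ n < t.encode.length, r n = r' n) : t.eval r = t.eval r' := by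
  induction t with
  | var n => exact h n (by simp [encode])
  | zero | one => rfl
  | add t s iht ihs | sub t s iht ihs | mul t s iht ihs =>
    simp only [encode, List.length_cons, List.length_append] at h
    simp only [eval]
    rw [iht fun n hn => h n (by omega), ihs fun n hn => h n (by omega)]

theorem RingTerm.length_encode_le {t : RingTerm} {l : List RingTerm} (h : t ∈ l) :
    t.encode.length ≤ (encodeList l).length := by
  rw [encodeList, List.length_flatMap]
  exact List.le_sum_of_mem (List.mem_map_of_mem h)

/-- Every list over `ZMod p` is the value of a short binary word. -/
theorem exists_decode_eq (p : ℕ) [NeZero p] (l : List (ZMod p)) :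
    ∃ w : List Bool, w.length ≤ p * l.length ∧ decode w = l := by
  induction l with
  | nil => exact ⟨[], by simp, rfl⟩
  | cons a l ih =>
    obtain ⟨w, hw, rfl⟩ := ih
    -- New entries go to the front, so the tail is coded first. An entry takes one `false` and fewer
    -- than `p` times `true`, at most `p` bits.
    refine ⟨w ++ false :: List.replicate a.val true, ?_, ?_⟩
    · have := a.val_lt
      simp only [List.length_append, List.length_cons, List.length_replicate, mul_add, mul_one]
      omega
    · have : ∀ (n : ℕ) (b : ZMod p) (D : List (ZMod p)),
          (List.replicate n true).foldl decodeStep (b :: D) = (b + n) :: D := by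
        intro n
        induction n with
        | zero => simp
        | succ n ih =>
          intro b D
          rw [List.replicate_succ, List.foldl_cons]
          refine (ih (b + 1) D).trans ?_
          push_cast
          rw [add_assoc, add_comm (1 : ZMod p)]
      have h := this a.val 0 (decode w)
      rw [ZMod.natCast_zmod_val, zero_add] at h
      rw [decode, List.foldl_append]
      exact h

/-- Variables beyond the length of the system do not occur in it, so an assignment may be truncated
to a list of that bounded length. -/
theorem exists_certificate_iff (p : ℕ) [NeZero p] (e : BLatTerm × BLatTerm) :
    (∃ r : ℕ → ZMod p, ∀ τ ∈ system e, τ.eval r = 0) ↔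
      ∃ w : List Bool, w.length ≤ p * (500 * (2 * (BLatTerm.encodePair e).length + 1) ^ 4) ∧
        ∀ v ∈ (system e).map (RingTerm.eval fun n => (decode w : List (ZMod p)).getD n 0),
          v = 0 := by
  simp only [List.mem_map, forall_exists_index, and_imp, forall_apply_eq_imp_iff₂]
  constructor
  · rintro ⟨r, hr⟩
    set K := 500 * (2 * (BLatTerm.encodePair e).length + 1) ^ 4 with hK
    obtain ⟨w, hw, h⟩ := exists_decode_eq p ((List.range K).map r)
    refine ⟨w, by simpa using hw, fun τ hτ => ?_⟩
    rw [← hr τ hτ, h]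
    refine τ.eval_congr fun n hn => ?_
    have h₁ := RingTerm.length_encode_le hτ
    have h₂ := length_encode_system e
    have h₃ : n < K := by omega
    simp [List.getD, h₃]
  · rintro ⟨w, -, hw⟩
    exact ⟨_, hw⟩

/-- The verifier accepts the certificates that stand for a solution of the equations for a pair of
terms. -/
def accepts (p : ℕ) (e : BLatTerm × BLatTerm) (w : List Bool) : Bool :=
  decide (∀ v ∈ (system e).map (RingTerm.eval fun n => (decode w : List (ZMod p)).getD n 0), v = 0)

open Polynomial in
theorem polyTime_accepts (p : ℕ) [NeZero p] {α : Type} (ea : α → List LatSymbol)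
    (g : α → BLatTerm × BLatTerm) (h : ∀ x, ea x = BLatTerm.encodePair (g x)) :
    Nonempty (Turing.TM2ComputableInPolyTime
      (fun y : α × List Bool => ((ea y.1).map Sum.inl ++ y.2.map Sum.inr : List (LatSymbol ⊕ Bool)))
      (fun b : Bool => [b]) fun y => accepts p (g y.1) y.2) := by
  refine Prog.polyTime_of_runs (Γ := Alphabet (ZMod p)) verify .inp .ans
    (500 * (2 * X + 1) ^ 4 * (2 * X + 30) + 7 * X + 30) fun y => ?_
  have := does_verify (C := ZMod p) (g y.1) y.2 rfl
  have e₀ : (fun _ => []) = ({} : Mem (ZMod p)).stack := by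
    funext k; cases k <;> rfl
  rw [e₀, Mem.update_inp, Mem.update_ans, h]
  simpa [accepts] using this

open Polynomial in
theorem inNP_of_failsInChar (p : ℕ) [Fact p.Prime] {α : Type} {ea : α → List LatSymbol}
    {hea : Function.Injective ea} {Yes : α → Prop} (g : α → BLatTerm × BLatTerm)
    (h : ∀ x, ea x = BLatTerm.encodePair (g x)) (hY : ∀ x, Yes x ↔ FailsInChar.{u} p (g x)) :
    InNP ⟨α, LatSymbol, inferInstance, ea, hea, Yes⟩ := by
  refine ⟨(p : ℕ[X]) * (500 * (2 * X + 1) ^ 4), fun y => accepts p (g y.1) y.2,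
    polyTime_accepts p ea g h, fun x => ?_⟩
  simp only [hY, failsInChar_prime_iff, exists_certificate_iff, accepts, decide_eq_true_eq, h]
  simp

theorem pTimeReduces_of_failsInChar {R : Type} [Ring R] {p : ℕ}
    (hR : ∀ e, FailsInChar.{u} p e ↔ ∃ r : ℕ → R, ∀ τ ∈ system e, τ.eval r = 0)
    {α : Type} {ea : α → List LatSymbol}
    {hea : Function.Injective ea} {Yes : α → Prop} (g : α → BLatTerm × BLatTerm)
    (h : ∀ x, ea x = BLatTerm.encodePair (g x)) (hY : ∀ x, Yes x ↔ FailsInChar.{u} p (g x)) :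
    PTimeReduces ⟨α, LatSymbol, inferInstance, ea, hea, Yes⟩ (FEAS R) :=
  ⟨fun x => system (g x), polyTime_system ea g h, fun x => (hY x).trans (hR (g x))⟩

theorem LatTerm.encodePair_toBounded (e : LatTerm × LatTerm) :
    encodePair e = BLatTerm.encodePair (e.1.toBounded, e.2.toBounded) := by
  simp [encodePair, BLatTerm.encodePair, encode_toBounded]

end LatticeRefutability

open LatticeRefutability
theorem corollary11 :
    (PTimeReduces (REF (subspaceVariety.{u} 0)) (FEAS ℝ) ∧
      PTimeReduces (boundedREF (boundedSubspaceVariety.{u} 0)) (FEAS ℝ)) ∧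
    ∀ p : ℕ, p.Prime →
      (PTimeReduces (REF (subspaceVariety.{u} p)) (FEAS (ZMod p)) ∧
        PTimeReduces (boundedREF (boundedSubspaceVariety.{u} p)) (FEAS (ZMod p))) ∧
      (InNP (REF (subspaceVariety.{u} p)) ∧
        InNP (boundedREF (boundedSubspaceVariety.{u} p))) := by
  refine ⟨⟨?_, ?_⟩, fun p hp => ?_⟩
  · exact pTimeReduces_of_failsInChar failsInChar_zero_iff.{u}
      (fun e : LatTerm × LatTerm => (e.1.toBounded, e.2.toBounded)) LatTerm.encodePair_toBounded
      (REF_yes_iff.{u} 0)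
  · exact pTimeReduces_of_failsInChar failsInChar_zero_iff.{u} id (fun _ => rfl)
      (boundedREF_yes_iff.{u} 0)
  · have : Fact p.Prime := ⟨hp⟩
    refine ⟨⟨?_, ?_⟩, ?_, ?_⟩
    · exact pTimeReduces_of_failsInChar (failsInChar_prime_iff.{u} p)
        (fun e : LatTerm × LatTerm => (e.1.toBounded, e.2.toBounded)) LatTerm.encodePair_toBounded
        (REF_yes_iff.{u} p)
    · exact pTimeReduces_of_failsInChar (failsInChar_prime_iff.{u} p) id (fun _ => rfl)
        (boundedREF_yes_iff.{u} p)
    · exact inNP_of_failsInChar p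
        (fun e : LatTerm × LatTerm => (e.1.toBounded, e.2.toBounded)) LatTerm.encodePair_toBounded
        (REF_yes_iff.{u} p)
    · exact inNP_of_failsInChar p id (fun _ => rfl) (boundedREF_yes_iff.{u} p)
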